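/- Let $r,p\ge 1$ and $m\ge p+r$ be integers, let $a_{-r},\dots,a_p\in\mathbb C$ with $a_{-r}\ne0$ and $a_p\neq 0$, and let $B=(b_{j,k})_{-r\le j\le -1,\;0\le k\le m-1}\in\mathcal M_{r,m}(\mathbb C)$. Consider the scheme $U_j^{n+1}=\sum_{k=-r}^p a_kU_{j+k}^n$ $(j\ge 0)$ with boundary conditions $U_j^n=\sum_{k=0}^{m-1}b_{j,k}U_k^n+g_j^n$ $(-r\le j\le -1)$, and let $\mathcal B\in\mathcal M_{r,m}(\mathbb C)$ be the matrix obtained by substituting the boundary conditions into the scheme for $0\le j\le r-1$, that is, $\mathcal B=TB+S$, where, for $0\le i,l\le r-1$ and $0\le k\le m-1$, $T_{i,l}=a_{-r+l-i}$ if $i\le l$ and $T_{i,l}=0$ otherwise, and $S_{i,k}=a_{k-i}$ if $k-i\le p$ and $S_{i,k}=0$ otherwise (row $l$ of $B$ being $(b_{l-r,k})_k$). Assume that the scheme is Cauchy stable: $\bigl|\sum_{k=-r}^p a_ke^{ik\xi}\bigr|\le 1$ for all $\xi\in\mathbb R$. Write $\mathbb S=\{|z|=1\}$, $\mathbb D=\{|z|<1\}$,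 $\mathcal U=\{|z|>1\}$ and $\overline{\mathcal U}=\{|z|\ge1\}$. For $z\in\mathcal U$, the polynomial $P_z(\kappa)=\sum_{k=-r}^p a_k\kappa^{r+k}-z\kappa^r$ has exactly $r$ roots in $\mathbb D$, counted with multiplicity; call them the stable roots at $z$. For $z\in\mathbb S$, the stable roots at $z$ are the roots of $P_z$ coming from $\mathbb D$, i.e. the limit (as an unordered $r$-tuple) of the stable roots at $w$ as $w\to z$, $w\in\mathcal U$. For $z\in\overline{\mathcal U}$ and $n\ge 1$, let $K_{0,n-1}(z)\in\mathcal M_{n,r}(\mathbb C)$ be the matrix whose columns are the vectors $(j^s\kappa^j)_{0\le j\le n-1}$, where $\kappa$ runs through the distinct stable roots at $z$ and $0\le s<\mu(\kappa)$ with $\mu(\kappa)$ the multiplicity of $\kappa$ among the stable roots (and $0^0=1$). The intrinsic Kreiss--Lopatinskii determinant is $$\Delta(z)=\frac{\det\bigl(zK_{0,r-1}(z)-\mathcal B K_{0,m-1}(z)\bigr)}{\det K_{0,r-1}(z)},\qquad z\in\overline{\mathcal U},$$ which does not depend on the order of the columns. If $0\notin\Delta(\mathbb S)$, then $\Delta$,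 which is holomorphic on $\mathcal U$ and continuous on $\overline{\mathcal U}$, has finitely many zeros in $\mathcal U$, and their number, counted with multiplicity, is exactly $$r-\mathrm{Ind}_{\Delta(\mathbb S)}(0),$$ where $\mathrm{Ind}_{\Delta(\mathbb S)}(0)\in\mathbb Z$ is the winding number around $0$ of the closed curve $\theta\in[0,2\pi]\mapsto\Delta(e^{i\theta})$. -/

import Mathlib

noncomputable section

namespace KreissLopatinskii

/-- The symbol `γ(ξ) = ∑_{k=-r}^p a_k e^{ikξ}` of the scheme
`U_j^{n+1} = ∑_{k=-r}^p a_k U_{j+k}^n`. Only the values `a k`, `-r ≤ k ≤ p`, matter. -/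
def symbol (r p : ℕ) (a : ℤ → ℂ) (ξ : ℝ) : ℂ :=
  ∑ k ∈ Finset.Icc (-(r : ℤ)) (p : ℤ), a k * Complex.exp (Complex.I * (k : ℂ) * (ξ : ℂ))

/-- Cauchy stability: the symbol takes its values in the closed unit disk. -/
def CauchyStable (r p : ℕ) (a : ℤ → ℂ) : Prop :=
  ∀ ξ : ℝ, ‖symbol r p a ξ‖ ≤ 1

/-- The matrix `𝓑 ∈ M_{r,m}(ℂ)` obtained by substituting the boundary conditions
`U_j = ∑_{k=0}^{m-1} b_{j,k} U_k + g_j`, `-r ≤ j ≤ -1`, into the interior scheme at the indices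
`0, …, r-1`. The row `l` of `B` holds the coefficients `b_{l-r,k}`. -/
def boundaryMatrix (r p m : ℕ) (a : ℤ → ℂ) (B : Matrix (Fin r) (Fin m) ℂ) :
    Matrix (Fin r) (Fin m) ℂ :=
  (Matrix.of fun i l : Fin r => if i ≤ l then a (-(r : ℤ) + ((l : ℤ) - (i : ℤ))) else 0) * B +
    Matrix.of fun (i : Fin r) (k : Fin m) =>
      if (k : ℤ) - (i : ℤ) ≤ (p : ℤ) then a ((k : ℤ) - (i : ℤ)) else 0

/-- The polynomial `P_z(κ) = ∑_{k=-r}^p a_k κ^{r+k} - z κ^r` of the characteristic equation. -/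
def charPoly (r p : ℕ) (a : ℤ → ℂ) (z : ℂ) : Polynomial ℂ :=
  (∑ l ∈ Finset.range (r + p + 1), Polynomial.C (a ((l : ℤ) - (r : ℤ))) * Polynomial.X ^ l) -
    Polynomial.C z * Polynomial.X ^ r

/-- `κ` lists, with multiplicity, the roots of `P_z` in the open unit disk. -/
def EnumeratesInnerRoots (r p : ℕ) (a : ℤ → ℂ) (z : ℂ) (κ : Fin r → ℂ) : Prop :=
  Finset.univ.val.map κ = (charPoly r p a z).roots.filter fun x => ‖x‖ < 1

/-- `κ` lists, with multiplicity, the stable roots at the point `z`, `|z| ≥ 1`. For `|z| > 1` these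
are the roots of `P_z` in the open unit disk; for `|z| = 1` these are the roots of `P_z` that come
from the inside, i.e. the limit, as an unordered `r`-tuple, of the roots of `P_w` in the open unit
disk as `w → z` with `|w| > 1`. -/
def IsStableRoots (r p : ℕ) (a : ℤ → ℂ) (z : ℂ) (κ : Fin r → ℂ) : Prop :=
  (1 < ‖z‖ ∧ EnumeratesInnerRoots r p a z κ) ∨
  (‖z‖ = 1 ∧ ∀ ε > 0, ∃ δ > 0, ∀ w : ℂ, 1 < ‖w‖ → ‖w - z‖ < δ →
    ∃ κ' : Fin r → ℂ, EnumeratesInnerRoots r p a w κ' ∧ ∀ i, ‖κ' i - κ i‖ < ε)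

open Classical in
/-- A choice of an ordering of the `r` stable roots at `z`. -/
def stableRoots (r p : ℕ) (a : ℤ → ℂ) (z : ℂ) : Fin r → ℂ :=
  if h : ∃ κ, IsStableRoots r p a z κ then h.choose else 0

/-- The rows `0, …, n-1` of the basis `(j^s κ_ℓ^j)_j`, `0 ≤ s < mult(κ_ℓ)`, attached to a list `κ`
of roots in which each root occurs as often as its multiplicity: the exponent `s` of a column is the
number of earlier occurrences of the same root. -/
def basisMatrix {r : ℕ} (n : ℕ) (κ : Fin r → ℂ) : Matrix (Fin n) (Fin r) ℂ :=
  Matrix.of fun j i =>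
    ((j : ℕ) : ℂ) ^ (Finset.univ.filter fun l : Fin r => l < i ∧ κ l = κ i).card * κ i ^ (j : ℕ)

/-- The matrix `K_{0,n-1}(z)`. -/
def K (r p : ℕ) (a : ℤ → ℂ) (n : ℕ) (z : ℂ) : Matrix (Fin n) (Fin r) ℂ :=
  basisMatrix n (stableRoots r p a z)

/-- The Kreiss-Lopatinskii determinant `det (z K_{0,r-1}(z) - 𝓑 K_{0,m-1}(z))`. -/
def detKL (r p m : ℕ) (a : ℤ → ℂ) (B : Matrix (Fin r) (Fin m) ℂ) (z : ℂ) : ℂ :=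
  (z • K r p a r z - boundaryMatrix r p m a B * K r p a m z).det

/-- The intrinsic Kreiss-Lopatinskii determinant `Δ`, for `|z| ≥ 1`. -/
def intrinsicDet (r p m : ℕ) (a : ℤ → ℂ) (B : Matrix (Fin r) (Fin m) ℂ) (z : ℂ) : ℂ :=
  detKL r p m a B z / (K r p a r z).det

/-- The integer `w` is the winding number around `z₀` of the closed curve `c : [0, 2π] → ℂ`:
there is a continuous logarithm of `c - z₀` along `[0, 2π]` that increases by `2πi w`. -/
def HasWindingNumber (c : ℝ → ℂ) (z₀ : ℂ) (w : ℤ) : Prop :=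
  ∃ L : ℝ → ℂ, ContinuousOn L (Set.Icc 0 (2 * Real.pi)) ∧
    (∀ θ ∈ Set.Icc 0 (2 * Real.pi), c θ - z₀ = Complex.exp (L θ)) ∧
    L (2 * Real.pi) - L 0 = 2 * (Real.pi : ℂ) * Complex.I * (w : ℂ)

theorem HasWindingNumber.unique {c : ℝ → ℂ} {z₀ : ℂ} {w w' : ℤ}
    (h : HasWindingNumber c z₀ w) (h' : HasWindingNumber c z₀ w') : w = w' := by
  obtain ⟨L, hL, hc, hw⟩ := h
  obtain ⟨L', hL', hc', hw'⟩ := h'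
  have hpi : (0 : ℝ) ≤ 2 * Real.pi := by positivity
  have key : ∀ θ ∈ Set.Icc 0 (2 * Real.pi), ∃ n : ℤ,
      L θ = L' θ + n * (2 * Real.pi * Complex.I) := fun θ hθ =>
    Complex.exp_eq_exp_iff_exists_int.1 ((hc θ hθ).symm.trans (hc' θ hθ))
  have hne : (2 * (Real.pi : ℂ) * Complex.I) ≠ 0 := Complex.two_pi_I_ne_zero
  have hcont : ContinuousOn (fun θ => ((L θ - L' θ) / (2 * Real.pi * Complex.I)).re)
      (Set.Icc 0 (2 * Real.pi)) :=
    Complex.continuous_re.comp_continuousOn ((hL.sub hL').div_const _)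
  have hval : ∀ θ ∈ Set.Icc 0 (2 * Real.pi), ∃ n : ℤ,
      L θ - L' θ = n * (2 * Real.pi * Complex.I) ∧
      ((L θ - L' θ) / (2 * Real.pi * Complex.I)).re = n := by
    intro θ hθ
    obtain ⟨n, hn⟩ := key θ hθ
    have e : L θ - L' θ = n * (2 * Real.pi * Complex.I) := by rw [hn]; ring
    refine ⟨n, e, ?_⟩
    rw [e, mul_div_cancel_right₀ _ hne]
    simp
  obtain ⟨n₀, e₀, v₀⟩ := hval 0 ⟨le_rfl, hpi⟩
  obtain ⟨n₁, e₁, v₁⟩ := hval (2 * Real.pi) ⟨hpi, le_rfl⟩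
  have hn : n₀ = n₁ := by
    have hconn := (isPreconnected_Icc (a := (0 : ℝ)) (b := 2 * Real.pi)).image _ hcont
    have hsub : (fun θ => ((L θ - L' θ) / (2 * Real.pi * Complex.I)).re) ''
        Set.Icc 0 (2 * Real.pi) ⊆ Set.range ((↑) : ℤ → ℝ) := by
      rintro _ ⟨θ, hθ, rfl⟩
      obtain ⟨n, -, hn⟩ := hval θ hθ
      exact ⟨n, hn.symm⟩
    have hd : (Set.range ((↑) : ℤ → ℝ)).Countable := Set.countable_range _
    have hs := hd.isTotallyDisconnected _ hsub hconn
    have := hs ⟨0, ⟨le_rfl, hpi⟩, rfl⟩ ⟨2 * Real.pi, ⟨hpi, le_rfl⟩, rfl⟩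
    simp only [v₀, v₁] at this
    exact_mod_cast this
  have e : ((w : ℂ) - w') * (2 * Real.pi * Complex.I) = 0 := by
    have : L (2 * Real.pi) - L' (2 * Real.pi) = L 0 - L' 0 := by rw [e₀, e₁, hn]
    linear_combination (-1 : ℂ) * hw + hw' + this
  have := (mul_eq_zero.1 e).resolve_right hne
  exact_mod_cast sub_eq_zero.1 this

open Classical in
/-- The winding number around `z₀` of a closed curve `c : [0, 2π] → ℂ`; it is defined whenever `c`
is continuous on `[0, 2π]`, closed, and avoids `z₀`. -/
def windingNumber (c : ℝ → ℂ) (z₀ : ℂ) : ℤ :=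
  if h : ∃ w, HasWindingNumber c z₀ w then h.choose else 0

end KreissLopatinskii

end

noncomputable section

namespace KreissLopatinskii

open Polynomial Topology Filter Metric

/-! The quotient `Δ` depends on the stable roots only through the monic polynomial `Q_z` having them
as roots. A column of `K` is the functional `f ↦ ((X d/dX)^s f)(κ)` applied to `1, X, X², …`. These
functionals vanish on multiples of `Q_z`, so each `X^j` may be replaced by its remainder modulo
`Q_z`: `K_{0,m-1} = R K_{0,r-1}`, where the entries of `R` are polynomials in the coefficients of
`Q_z`. As the confluent Vandermonde matrix `K_{0,r-1}` is invertible, `Δ(z) = det (z - 𝓑 R)`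
(`det_basisMatrix_quotient`).

It remains to study the coefficients of `Q_z`. By Cauchy stability `|P_w(x)| ≥ |w| - 1 > 0` for `|x|
= 1 < |w|`. The power sums of the roots inside the disk are therefore contour integrals, holomorphic
in `w`, and Newton's identities transfer holomorphy to the coefficients. At a point `z` of the
circle the possible limits of `Q_w` form a finite set, since their roots are roots of `P_z`; small
connected neighbourhoods in the exterior leave only one of them (`exists_tendsto_innerCoeff`), so
the coefficients extend continuously. At infinity the stable roots tend to `0`, whence `Δ(z) / z^r →
1`.

The count is then an argument principle in the exterior. Write `Δ = ∏ (z - s)^{n_s} G` with `G`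
nowhere zero, and put `N = r - ∑ n_s`. The function `G(1/ζ) ζ^N` extends to the closed disk without
zeros, hence has a continuous logarithm there; each `z - s` with `|s| > 1` has one on the circle.
Only the remaining factor `z^N` winds, so the index is `N` (`hasWindingNumber_of_factorization`). -/

/-! ### The basis matrix and remainders modulo the polynomial of the roots -/

/-- The Euler operator `f ↦ X f'`. -/
def euler (f : ℂ[X]) : ℂ[X] := X * derivative f

theorem euler_add (f g : ℂ[X]) : euler (f + g) = euler f + euler g := by
  simp [euler, mul_add]

theorem euler_C_mul (c : ℂ) (f : ℂ[X]) : euler (C c * f) = C c * euler f := by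
  simp only [euler, derivative_C_mul]; ring

theorem iterate_euler_add (s : ℕ) (f g : ℂ[X]) :
    euler^[s] (f + g) = euler^[s] f + euler^[s] g := by
  induction s generalizing f g with
  | zero => rfl
  | succ s ih => simp only [Function.iterate_succ, Function.comp, euler_add, ih]

theorem iterate_euler_C_mul (s : ℕ) (c : ℂ) (f : ℂ[X]) :
    euler^[s] (C c * f) = C c * euler^[s] f := by
  induction s generalizing f with
  | zero => rfl
  | succ s ih => simp only [Function.iterate_succ, Function.comp, euler_C_mul, ih]

theorem iterate_euler_zero (s : ℕ) : euler^[s] 0 = 0 := by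
  simpa using iterate_euler_C_mul s 0 0

theorem iterate_euler_sum {ι : Type*} (s : ℕ) (t : Finset ι) (f : ι → ℂ[X]) :
    euler^[s] (∑ i ∈ t, f i) = ∑ i ∈ t, euler^[s] (f i) := by
  classical
  induction t using Finset.induction_on with
  | empty => simp [iterate_euler_zero]
  | insert i t hi ih => rw [Finset.sum_insert hi, Finset.sum_insert hi, iterate_euler_add, ih]

theorem iterate_euler_X_pow (s j : ℕ) : euler^[s] (X ^ j : ℂ[X]) = C ((j : ℂ) ^ s) * X ^ j := by
  induction s with
  | zero => simp
  | succ s ih =>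
    rw [Function.iterate_succ_apply', ih, euler_C_mul, euler]
    rcases j with _ | j
    · simp
    · rw [derivative_X_pow]
      simp only [Nat.add_sub_cancel, pow_succ, map_mul]
      ring

/-- Applying the Euler operator `s` times lowers the order of vanishing at `c` by at most `s`. -/
theorem iterate_euler_X_sub_C_pow_mul (c : ℂ) (s n : ℕ) (g : ℂ[X]) :
    ∃ h : ℂ[X], euler^[s] ((X - C c) ^ (n + s) * g) = (X - C c) ^ n * h ∧
      h.eval c = ((n + s).descFactorial s : ℂ) * c ^ s * g.eval c := by
  induction s generalizing g with
  | zero => exact ⟨g, by simp⟩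
  | succ s ih =>
    -- This is the cofactor left when one application of `X d/dX` to `(X - c)^(n+s+1) g` is divided
    -- by `(X - c)^(n+s)`.
    obtain ⟨h, hh, he⟩ := ih (C ((n + s + 1 : ℕ) : ℂ) * X * g + (X - C c) * X * derivative g)
    refine ⟨h, ?_, ?_⟩
    · rw [Function.iterate_succ_apply, ← hh]
      congr 1
      rw [euler, ← add_assoc, derivative_mul, derivative_X_sub_C_pow]
      simp only [Nat.add_sub_cancel, map_natCast]
      ring
    · rw [he, ← add_assoc, Nat.succ_descFactorial_succ]
      simp
      ring

theorem eval_iterate_euler_of_dvd {c : ℂ} {μ s : ℕ} (hs : s < μ) {f : ℂ[X]}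
    (hf : (X - C c) ^ μ ∣ f) : (euler^[s] f).eval c = 0 := by
  obtain ⟨g, rfl⟩ := hf
  obtain ⟨n, rfl⟩ : ∃ n, μ = (n + 1) + s := ⟨μ - s - 1, by omega⟩
  obtain ⟨h, hh, -⟩ := iterate_euler_X_sub_C_pow_mul c s (n + 1) g
  rw [hh]
  simp

/-- If `f = (X - c)^μ g`, the `μ`-th Euler iterate at `c` equals `μ! c^μ g(c)`. The factor `c^μ` is
why `c ≠ 0` is needed: at `0` the Euler operator does not see derivatives. -/
theorem dvd_of_eval_iterate_euler {c : ℂ} (hc : c ≠ 0) {μ : ℕ} {f : ℂ[X]}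
    (hf : ∀ s < μ, (euler^[s] f).eval c = 0) : (X - C c) ^ μ ∣ f := by
  induction μ with
  | zero => simp
  | succ μ ih =>
    obtain ⟨g, rfl⟩ := ih fun s hs => hf s (by omega)
    obtain ⟨h, hh, he⟩ := iterate_euler_X_sub_C_pow_mul c μ 0 g
    have h0 := hf μ (by omega)
    rw [zero_add] at hh he
    rw [hh] at h0
    have hg : g.eval c = 0 := by
      simp only [pow_zero, one_mul, he, Nat.descFactorial_self, mul_eq_zero, pow_eq_zero_iff',
        Nat.cast_eq_zero, Nat.factorial_ne_zero, hc, false_and, false_or] at h0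
      exact h0
    rw [pow_succ]
    exact mul_dvd_mul_left _ (dvd_iff_isRoot.2 hg)

/-- The monic polynomial with roots `κ`. -/
def rootPoly {r : ℕ} (κ : Fin r → ℂ) : ℂ[X] := ∏ i, (X - C (κ i))

theorem rootPoly_monic {r : ℕ} (κ : Fin r → ℂ) : (rootPoly κ).Monic :=
  monic_prod_of_monic _ _ fun _ _ => monic_X_sub_C _

theorem rootPoly_natDegree {r : ℕ} (κ : Fin r → ℂ) : (rootPoly κ).natDegree = r := by
  rw [rootPoly, natDegree_prod_of_monic _ _ fun _ _ => monic_X_sub_C _]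
  simp

theorem rootPoly_eq_multiset_prod {r : ℕ} (κ : Fin r → ℂ) :
    rootPoly κ = ((Finset.univ.val.map κ).map fun x => X - C x).prod := by
  rw [rootPoly, Multiset.map_map]; rfl

theorem rootPoly_roots {r : ℕ} (κ : Fin r → ℂ) : (rootPoly κ).roots = Finset.univ.val.map κ := by
  rw [rootPoly_eq_multiset_prod, roots_multiset_prod_X_sub_C]

/-- The number of earlier occurrences of the entry `κ i`. -/
def rank {r : ℕ} (κ : Fin r → ℂ) (i : Fin r) : ℕ :=
  (Finset.univ.filter fun l : Fin r => l < i ∧ κ l = κ i).card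

theorem card_filter_eq_count {r : ℕ} (κ : Fin r → ℂ) (c : ℂ) :
    (Finset.univ.filter fun l : Fin r => κ l = c).card = (Finset.univ.val.map κ).count c := by
  rw [Multiset.count_map, Finset.card_def, Finset.filter_val]
  simp only [eq_comm]

theorem rank_lt_card {r : ℕ} (κ : Fin r → ℂ) (i : Fin r) :
    rank κ i < (Finset.univ.filter fun l : Fin r => κ l = κ i).card := by
  refine Finset.card_lt_card (Finset.ssubset_iff_of_subset ?_ |>.2 ⟨i, by simp, by simp⟩)
  intro l; simp +contextual

theorem rank_injOn {r : ℕ} (κ : Fin r → ℂ) (c : ℂ) {i j : Fin r} (hi : κ i = c) (hj : κ j = c)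
    (h : rank κ i = rank κ j) : i = j := by
  have key : ∀ i j : Fin r, κ i = c → κ j = c → i < j → rank κ i < rank κ j := by
    intro i j hi hj hij
    refine Finset.card_lt_card
      (Finset.ssubset_iff_of_subset ?_ |>.2 ⟨i, by simp [hi, hj, hij], by simp⟩)
    intro l
    simp only [Finset.mem_filter, Finset.mem_univ, true_and, hi, hj]
    exact fun h => ⟨h.1.trans hij, h.2⟩
  rcases lt_trichotomy i j with h' | h' | h'
  · exact absurd h (key i j hi hj h').ne
  · exact h'
  · exact absurd h (key j i hj hi h').ne'

/-- On the occurrences of `c` the rank is injective and smaller than their number, so it takes every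
value below the multiplicity. The columns thus carry all the exponents `0 ≤ s < μ(c)`. -/
theorem exists_rank_eq {r : ℕ} (κ : Fin r → ℂ) (c : ℂ) {s : ℕ}
    (hs : s < (Finset.univ.filter fun l : Fin r => κ l = c).card) :
    ∃ i, κ i = c ∧ rank κ i = s := by
  have himg : (Finset.univ.filter fun l : Fin r => κ l = c).image (rank κ) =
      Finset.range (Finset.univ.filter fun l : Fin r => κ l = c).card := by
    refine Finset.eq_of_subset_of_card_le ?_ ?_
    · intro x hx
      obtain ⟨i, hi, rfl⟩ := Finset.mem_image.1 hx
      obtain rfl := (Finset.mem_filter.1 hi).2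
      exact Finset.mem_range.2 (rank_lt_card κ i)
    · rw [Finset.card_range, Finset.card_image_of_injOn]
      intro i hi j hj h
      simp only [Finset.coe_filter, Finset.mem_univ, true_and, Set.mem_ofPred_eq] at hi hj
      exact rank_injOn κ c hi hj h
  have := Finset.mem_range.2 hs
  rw [← himg, Finset.mem_image] at this
  obtain ⟨i, hi, h⟩ := this
  exact ⟨i, (Finset.mem_filter.1 hi).2, h⟩

theorem basisMatrix_apply {r : ℕ} (n : ℕ) (κ : Fin r → ℂ) (j : Fin n) (i : Fin r) :
    basisMatrix n κ j i = (euler^[rank κ i] (X ^ (j : ℕ))).eval (κ i) := by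
  rw [iterate_euler_X_pow]
  simp [basisMatrix, rank]

theorem X_sub_C_pow_dvd_rootPoly {r : ℕ} (κ : Fin r → ℂ) (c : ℂ) :
    (X - C c) ^ (Finset.univ.filter fun l : Fin r => κ l = c).card ∣ rootPoly κ := by
  rw [← Polynomial.le_rootMultiplicity_iff (rootPoly_monic κ).ne_zero, ← count_roots,
    rootPoly_roots, card_filter_eq_count]

theorem eval_iterate_euler_of_rootPoly_dvd {r : ℕ} (κ : Fin r → ℂ) (i : Fin r) {f : ℂ[X]}
    (hf : rootPoly κ ∣ f) : (euler^[rank κ i] f).eval (κ i) = 0 :=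
  eval_iterate_euler_of_dvd (rank_lt_card κ i) ((X_sub_C_pow_dvd_rootPoly κ (κ i)).trans hf)

theorem rootPoly_dvd_of_eval_iterate_euler {r : ℕ} (κ : Fin r → ℂ) (h0 : ∀ i, κ i ≠ 0) {f : ℂ[X]}
    (hf : ∀ i, (euler^[rank κ i] f).eval (κ i) = 0) : rootPoly κ ∣ f := by
  classical
  rcases eq_or_ne f 0 with rfl | hne
  · simp
  rw [rootPoly_eq_multiset_prod, Multiset.prod_X_sub_C_dvd_iff_le_roots hne, Multiset.le_iff_count]
  intro c
  rw [← card_filter_eq_count, count_roots, le_rootMultiplicity_iff hne]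
  by_cases hc : ∃ i, κ i = c
  · obtain ⟨i, rfl⟩ := hc
    refine dvd_of_eval_iterate_euler (h0 i) fun s hs => ?_
    obtain ⟨j, hj, rfl⟩ := exists_rank_eq κ (κ i) hs
    rw [← hj]
    exact hf j
  · push Not at hc
    rw [Finset.filter_false_of_mem fun i _ => hc i]
    simp

/-- A vector in the left kernel is the coefficient list of a polynomial of degree `< r` killed by
all the column functionals. That polynomial is divisible by `rootPoly κ`, of degree `r`, so it is
zero. -/
theorem det_basisMatrix_ne_zero {r : ℕ} (κ : Fin r → ℂ) (h0 : ∀ i, κ i ≠ 0) :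
    (basisMatrix r κ).det ≠ 0 := by
  intro hdet
  obtain ⟨v, hv, hv0⟩ := Matrix.exists_vecMul_eq_zero_iff.2 hdet
  apply hv
  set f : ℂ[X] := ∑ j : Fin r, C (v j) * X ^ (j : ℕ) with hf
  have hdvd : rootPoly κ ∣ f := by
    refine rootPoly_dvd_of_eval_iterate_euler κ h0 fun i => ?_
    have := congrFun hv0 i
    rw [hf, iterate_euler_sum, eval_finsetSum]
    simp only [iterate_euler_C_mul, eval_mul, eval_C, ← basisMatrix_apply]
    exact this
  have hfz : f = 0 := by
    refine eq_zero_of_dvd_of_degree_lt hdvd ?_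
    rw [degree_eq_natDegree (rootPoly_monic κ).ne_zero, rootPoly_natDegree]
    exact degree_sum_fin_lt v
  funext j
  have := congrArg (fun q : ℂ[X] => q.coeff j) hfz
  simpa [hf, coeff_X_pow, Fin.val_inj] using this

/-- The coefficients of the remainder of `X ^ j` modulo the monic polynomial of degree `r` with
lower coefficients `q`. -/
def remCoeff (r : ℕ) (q : ℕ → ℂ) : ℕ → ℕ → ℂ
  -- Passing from `j` to `j + 1` multiplies the remainder by `X` and subtracts its top coefficient,
  -- of index `r - 1`, times the monic polynomial. The entries are thus visibly polynomials in `q`.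
  | 0, i => if i = 0 then 1 else 0
  | j + 1, 0 => -(remCoeff r q j (r - 1) * q 0)
  | j + 1, i + 1 => remCoeff r q j i - remCoeff r q j (r - 1) * q (i + 1)

theorem dvd_X_pow_sub_remCoeff {r : ℕ} (hr : 1 ≤ r) {Q : ℂ[X]} (hQ : Q.Monic)
    (hd : Q.natDegree = r) (j : ℕ) :
    Q ∣ X ^ j - ∑ i ∈ Finset.range r, C (remCoeff r Q.coeff j i) * X ^ i := by
  obtain ⟨n, rfl⟩ : ∃ n, r = n + 1 := ⟨r - 1, by omega⟩
  have hQs : Q = ∑ i ∈ Finset.range (n + 1), C (Q.coeff i) * X ^ i + X ^ (n + 1) := by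
    conv_lhs => rw [hQ.as_sum, hd]
    ring
  induction j with
  | zero =>
    have : (∑ i ∈ Finset.range (n + 1), C (remCoeff (n + 1) Q.coeff 0 i) * X ^ i : ℂ[X]) = 1 := by
      rw [Finset.sum_eq_single 0] <;> simp +contextual [remCoeff]
    rw [this]; simp
  | succ j ih =>
    have key : (∑ i ∈ Finset.range (n + 1), C (remCoeff (n + 1) Q.coeff (j + 1) i) * X ^ i : ℂ[X]) =
        X * ∑ i ∈ Finset.range (n + 1), C (remCoeff (n + 1) Q.coeff j i) * X ^ i
          - C (remCoeff (n + 1) Q.coeff j n) * Q := by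
      have h2 := congrArg (fun q => C (remCoeff (n + 1) Q.coeff j n) * q) hQs
      rw [h2, Finset.sum_range_succ', Finset.sum_range_succ (n := n), Finset.sum_range_succ' _ n]
      simp only [remCoeff, Nat.add_sub_cancel, map_sub, map_neg, map_mul, sub_mul,
        Finset.sum_sub_distrib, mul_add, Finset.mul_sum]
      have e1 : ∀ i, (C (remCoeff (n + 1) Q.coeff j i) * X ^ (i + 1) : ℂ[X]) =
          X * (C (remCoeff (n + 1) Q.coeff j i) * X ^ i) := fun i => by ring
      simp only [e1, mul_assoc]
      ring
    rw [key]
    have : X ^ (j + 1) - (X * ∑ i ∈ Finset.range (n + 1), C (remCoeff (n + 1) Q.coeff j i) * X ^ i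
          - C (remCoeff (n + 1) Q.coeff j n) * Q) =
        X * (X ^ j - ∑ i ∈ Finset.range (n + 1), C (remCoeff (n + 1) Q.coeff j i) * X ^ i) +
          C (remCoeff (n + 1) Q.coeff j n) * Q := by ring
    rw [this]
    exact dvd_add (ih.mul_left _) (dvd_mul_left _ _)

/-- The matrix of the remainders of `1, X, …, X ^ (n - 1)`. -/
def remMatrix (n r : ℕ) (q : ℕ → ℂ) : Matrix (Fin n) (Fin r) ℂ :=
  Matrix.of fun j i => remCoeff r q j i

theorem basisMatrix_eq_remMatrix_mul {r : ℕ} (hr : 1 ≤ r) (n : ℕ) (κ : Fin r → ℂ) :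
    basisMatrix n κ = remMatrix n r (rootPoly κ).coeff * basisMatrix r κ := by
  ext j i
  have h := eval_iterate_euler_of_rootPoly_dvd κ i
    (dvd_X_pow_sub_remCoeff hr (rootPoly_monic κ) (rootPoly_natDegree κ) j)
  rw [sub_eq_add_neg, ← neg_one_mul, ← C_1, ← C_neg, iterate_euler_add, iterate_euler_C_mul,
    iterate_euler_sum, Finset.sum_range] at h
  simp only [eval_add, eval_mul, eval_C, eval_finsetSum, iterate_euler_C_mul] at h
  rw [Matrix.mul_apply]
  simp only [basisMatrix_apply, remMatrix, Matrix.of_apply]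
  linear_combination h

/-- Both terms have the right factor `basisMatrix r κ`, which cancels; what is left is symmetric in
the roots. -/
theorem det_basisMatrix_quotient {r m : ℕ} (hr : 1 ≤ r) (κ : Fin r → ℂ) (h0 : ∀ i, κ i ≠ 0) (z : ℂ)
    (A : Matrix (Fin r) (Fin m) ℂ) :
    (z • basisMatrix r κ - A * basisMatrix m κ).det / (basisMatrix r κ).det =
      (z • (1 : Matrix (Fin r) (Fin r) ℂ) - A * remMatrix m r (rootPoly κ).coeff).det := by
  rw [div_eq_iff (det_basisMatrix_ne_zero κ h0), ← Matrix.det_mul, Matrix.sub_mul,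
    Matrix.smul_mul, Matrix.one_mul, Matrix.mul_assoc, ← basisMatrix_eq_remMatrix_mul hr]

/-! ### The characteristic polynomial on the unit circle -/

theorem charPoly_eq_sub (r p : ℕ) (a : ℤ → ℂ) (z : ℂ) :
    charPoly r p a z = charPoly r p a 0 - C z * X ^ r := by
  simp [charPoly]

theorem charPoly_eval (r p : ℕ) (a : ℤ → ℂ) (z x : ℂ) :
    (charPoly r p a z).eval x = (charPoly r p a 0).eval x - z * x ^ r := by
  rw [charPoly_eq_sub]; simp

theorem charPoly_coeff_zero {r : ℕ} (p : ℕ) (a : ℤ → ℂ) (hr : 1 ≤ r) (z : ℂ) :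
    (charPoly r p a z).coeff 0 = a (-(r : ℤ)) := by
  have hr' : 0 ≠ r := by omega
  rw [charPoly, coeff_sub, finsetSum_coeff, Finset.sum_eq_single 0]
  · simp [coeff_X_pow, hr']
  · intro l _ hl
    simp [coeff_X_pow, hl.symm]
  · simp

theorem charPoly_ne_zero {r : ℕ} (p : ℕ) {a : ℤ → ℂ} (hr : 1 ≤ r) (har : a (-(r : ℤ)) ≠ 0) (z : ℂ) :
    charPoly r p a z ≠ 0 := by
  intro h
  apply har
  rw [← charPoly_coeff_zero p a hr z, h, coeff_zero]

theorem ne_zero_of_isRoot_charPoly {r p : ℕ} {a : ℤ → ℂ} (hr : 1 ≤ r) (har : a (-(r : ℤ)) ≠ 0)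
    {z x : ℂ} (hx : (charPoly r p a z).eval x = 0) : x ≠ 0 := by
  rintro rfl
  rw [← coeff_zero_eq_eval_zero, charPoly_coeff_zero p a hr] at hx
  exact har hx

theorem eval_charPoly_exp (r p : ℕ) (a : ℤ → ℂ) (ξ : ℝ) :
    (charPoly r p a 0).eval (Complex.exp (Complex.I * ξ)) =
      Complex.exp (Complex.I * ξ) ^ r * symbol r p a ξ := by
  have h : symbol r p a ξ = ∑ l ∈ Finset.range (r + p + 1),
      a ((l : ℤ) - r) * Complex.exp (Complex.I * ((((l : ℤ) - r : ℤ)) : ℂ) * ξ) := by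
    rw [symbol]
    symm
    refine Finset.sum_nbij (fun l : ℕ => (l : ℤ) - r) ?_ ?_ ?_ (fun _ _ => rfl)
    · intro l hl
      simp only [Finset.mem_range, Finset.mem_Icc] at hl ⊢
      omega
    · intro l _ l' _ h
      simp only at h
      omega
    · intro k hk
      simp only [Finset.coe_Icc, Set.mem_Icc] at hk
      exact ⟨(k + r).toNat, by simp; omega, by simp; omega⟩
  rw [h, Finset.mul_sum, charPoly]
  simp only [map_zero, zero_mul, sub_zero, eval_finsetSum, eval_mul, eval_C, eval_pow, eval_X]
  refine Finset.sum_congr rfl fun l _ => ?_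
  rw [mul_left_comm, ← Complex.exp_nat_mul, ← Complex.exp_nat_mul, ← Complex.exp_add]
  congr 2
  push_cast
  ring

theorem CauchyStable.norm_eval_le {r p : ℕ} {a : ℤ → ℂ} (h : CauchyStable r p a) {x : ℂ}
    (hx : ‖x‖ = 1) : ‖(charPoly r p a 0).eval x‖ ≤ 1 := by
  obtain ⟨ξ, rfl⟩ : ∃ ξ : ℝ, Complex.exp (Complex.I * ξ) = x := by
    obtain ⟨ξ, hξ⟩ := (Complex.norm_eq_one_iff x).1 hx
    exact ⟨ξ, by rw [mul_comm]; exact hξ⟩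
  rw [eval_charPoly_exp, norm_mul, norm_pow, hx, one_pow, one_mul]
  exact h ξ

theorem CauchyStable.le_norm_eval {r p : ℕ} {a : ℤ → ℂ} (h : CauchyStable r p a) {x : ℂ}
    (hx : ‖x‖ = 1) (w : ℂ) : ‖w‖ - 1 ≤ ‖(charPoly r p a w).eval x‖ := by
  rw [charPoly_eval, norm_sub_rev]
  have h1 := norm_sub_norm_le (w * x ^ r) ((charPoly r p a 0).eval x)
  have h2 := h.norm_eval_le hx
  rw [norm_mul, norm_pow, hx, one_pow, mul_one] at h1
  linarith

theorem CauchyStable.eval_ne_zero {r p : ℕ} {a : ℤ → ℂ} (h : CauchyStable r p a) {x w : ℂ}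
    (hx : ‖x‖ = 1) (hw : 1 < ‖w‖) : (charPoly r p a w).eval x ≠ 0 := by
  have := h.le_norm_eval hx w
  exact norm_pos_iff.1 (by linarith)

/-! ### Power sums of the roots in the unit disk -/

/-- Each simple fraction contributes `c^k` by Cauchy's formula when `|c| < 1`, and nothing by
Cauchy's theorem when `|c| > 1`. -/
theorem circleIntegral_pow_mul_sum (k : ℕ) (s : Multiset ℂ) (hs : ∀ c ∈ s, ‖c‖ ≠ 1) :
    CircleIntegrable (fun x : ℂ => x ^ k * (s.map fun c => 1 / (x - c)).sum) 0 1 ∧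
    (∮ x in C(0, 1), x ^ k * (s.map fun c => 1 / (x - c)).sum) =
      2 * Real.pi * Complex.I * ((s.filter fun x => ‖x‖ < 1).map fun x => x ^ k).sum := by
  induction s using Multiset.induction_on with
  | empty => simp [circleIntegral, CircleIntegrable]
  | cons c s ih =>
    obtain ⟨ih1, ih2⟩ := ih fun x hx => hs x (Multiset.mem_cons_of_mem hx)
    have hc := hs c (Multiset.mem_cons_self c s)
    have hne : ∀ x ∈ sphere (0 : ℂ) 1, x - c ≠ 0 := by
      intro x hx h
      rw [sub_eq_zero] at h
      exact hc (by rw [← h]; simpa using hx)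
    have hcont : ContinuousOn (fun x : ℂ => x ^ k * (1 / (x - c))) (sphere 0 1) :=
      (continuousOn_id.pow k).mul (continuousOn_const.div (continuousOn_id.sub continuousOn_const) hne)
    have hint : CircleIntegrable (fun x : ℂ => x ^ k * (1 / (x - c))) 0 1 :=
      hcont.circleIntegrable zero_le_one
    simp only [Multiset.map_cons, Multiset.sum_cons, mul_add]
    refine ⟨hint.add ih1, ?_⟩
    rw [circleIntegral.integral_add hint ih1, ih2]
    rcases lt_or_gt_of_ne hc with h | h
    · rw [Multiset.filter_cons_of_pos (p := fun x : ℂ => ‖x‖ < 1) s h, Multiset.map_cons,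
        Multiset.sum_cons, mul_add]
      congr 1
      have hd : DifferentiableOn ℂ (fun x : ℂ => x ^ k) (closedBall 0 1) := by fun_prop
      have := hd.circleIntegral_sub_inv_smul (w := c) (by simpa using h)
      simp only [smul_eq_mul] at this
      rw [← this]
      congr 1
      funext x
      rw [one_div, mul_comm]
    · rw [Multiset.filter_cons_of_neg (p := fun x : ℂ => ‖x‖ < 1) s (not_lt.2 h.le)]
      have : (∮ x in C(0, 1), x ^ k * (1 / (x - c))) = 0 := by
        refine Complex.circleIntegral_eq_zero_of_differentiable_on_off_countable zero_le_one
          (s := ∅) Set.countable_empty ?_ ?_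
        · refine (continuousOn_id.pow k).mul (continuousOn_const.div
            (continuousOn_id.sub continuousOn_const) ?_)
          intro x hx h'
          change x - c = 0 at h'
          rw [sub_eq_zero] at h'
          rw [mem_closedBall_zero_iff, h'] at hx
          linarith
        · intro x hx
          have : x - c ≠ 0 := by
            intro h'
            rw [sub_eq_zero] at h'
            rw [Set.sdiff_empty, mem_ball_zero_iff, h'] at hx
            linarith
          fun_prop (disch := assumption)
      rw [this, zero_add]

/-- The roots in the open unit disk. -/
def innerRoots (r p : ℕ) (a : ℤ → ℂ) (w : ℂ) : Multiset ℂ :=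
  (charPoly r p a w).roots.filter fun x => ‖x‖ < 1

/-- The power sums of the roots in the open unit disk. -/
def innerPowerSum (r p : ℕ) (a : ℤ → ℂ) (k : ℕ) (w : ℂ) : ℂ :=
  ((innerRoots r p a w).map fun x => x ^ k).sum

/-- The numerator of `x ^ k (P' / P - r / x)`. -/
def powerSumNumerator (r p : ℕ) (a : ℤ → ℂ) (k : ℕ) (x : ℂ) : ℂ :=
  x ^ k * ((derivative (charPoly r p a 0)).eval x - r * ((charPoly r p a 0).eval x * x⁻¹))

theorem continuousOn_powerSumNumerator (r p : ℕ) (a : ℤ → ℂ) (k : ℕ) :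
    ContinuousOn (powerSumNumerator r p a k) (sphere 0 1) := by
  have h0 : ∀ x ∈ sphere (0 : ℂ) 1, x ≠ 0 := fun x hx => ne_zero_of_mem_unit_sphere ⟨x, hx⟩
  unfold powerSumNumerator
  have : ContinuousOn (fun x : ℂ => x⁻¹) (sphere 0 1) := continuousOn_id.inv₀ h0
  fun_prop

theorem continuousOn_powerSumIntegrand {r p : ℕ} {a : ℤ → ℂ} (h : CauchyStable r p a) (k : ℕ)
    {w : ℂ} (hw : 1 < ‖w‖) :
    ContinuousOn (fun x => powerSumNumerator r p a k x / (charPoly r p a w).eval x)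
      (sphere 0 1) :=
  (continuousOn_powerSumNumerator r p a k).div (Polynomial.continuous _).continuousOn
    fun x hx => h.eval_ne_zero (by simpa using hx) hw

/-- The residue formula for `x^k P_w'/P_w`. Subtracting `r/x` removes `w` from the numerator,
because `w x^r` has logarithmic derivative `r/x`; the remaining integral is then small for large
`w`. The subtracted part integrates to the term with `0^k`. -/
theorem two_pi_I_mul_innerPowerSum {r p : ℕ} {a : ℤ → ℂ} (hr : 1 ≤ r) (h : CauchyStable r p a)
    (har : a (-(r : ℤ)) ≠ 0) (k : ℕ) {w : ℂ} (hw : 1 < ‖w‖) :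
    2 * Real.pi * Complex.I * innerPowerSum r p a k w =
      2 * Real.pi * Complex.I * (r * (0 : ℂ) ^ k) +
      ∮ x in C(0, 1), powerSumNumerator r p a k x / (charPoly r p a w).eval x := by
  have h1 := (circleIntegral_pow_mul_sum k (charPoly r p a w).roots (by
    intro c hc h1
    exact h.eval_ne_zero h1 hw ((mem_roots (charPoly_ne_zero p hr har w)).1 hc))).2
  -- The multiset `{0}` accounts for the pole of `r/x`.
  have h2 := circleIntegral_pow_mul_sum k {0} (by simp)
  have h2' := h2.2
  simp only [Multiset.map_singleton, Multiset.sum_singleton, Multiset.filter_singleton, norm_zero,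
    zero_lt_one, if_true] at h2 h2'
  rw [innerPowerSum, innerRoots, ← h1]
  have e : 2 * Real.pi * Complex.I * (r * (0 : ℂ) ^ k) =
      ∮ x in C(0, 1), (r : ℂ) * (x ^ k * (1 / (x - 0))) := by
    rw [circleIntegral.integral_const_mul, h2']; ring
  have hint : CircleIntegrable (fun x : ℂ => (r : ℂ) * (x ^ k * (1 / (x - 0)))) 0 1 :=
    h2.1.const_smul (a := (r : ℂ))
  rw [e, ← circleIntegral.integral_add hint
    ((continuousOn_powerSumIntegrand h k hw).circleIntegrable zero_le_one)]
  refine circleIntegral.integral_congr zero_le_one fun x hx => ?_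
  have hx1 : ‖x‖ = 1 := by simpa using hx
  have hx0 : x ≠ 0 := norm_pos_iff.1 (by linarith)
  have hP := h.eval_ne_zero hx1 hw
  have hd := (IsAlgClosed.splits (charPoly r p a w)).eval_derivative_div_eval_of_ne_zero hP
  rw [← hd, powerSumNumerator, sub_zero, one_div]
  have hder : (derivative (charPoly r p a w)).eval x =
      (derivative (charPoly r p a 0)).eval x - w * r * x ^ r * x⁻¹ := by
    obtain ⟨n, rfl⟩ : ∃ n, r = n + 1 := ⟨r - 1, by omega⟩
    rw [charPoly_eq_sub, derivative_sub, derivative_C_mul, derivative_X_pow]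
    simp only [eval_sub, eval_mul, eval_C, eval_pow, eval_X, Nat.add_sub_cancel, pow_succ]
    field_simp
  have hev := charPoly_eval r p a w x
  rw [hder]
  rw [hev] at hP ⊢
  field_simp
  ring

/-! ### Holomorphy in the parameter -/

theorem differentiableAt_integral_div {F G H : ℝ → ℂ} (hF : Continuous F) (hG : Continuous G)
    (hH : Continuous H) (hb : ∀ t, ‖H t‖ = 1) (hG1 : ∀ t, ‖G t‖ ≤ 1) (b c : ℝ) {w₀ : ℂ}
    (hw : 1 < ‖w₀‖) :
    DifferentiableAt ℂ (fun w => ∫ t in b..c, F t / (G t - w * H t)) w₀ := by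
  -- With half the distance from `w₀` to the unit circle, the denominator stays at least `δ` for `w`
  -- in the ball of radius `δ`.
  set δ := (‖w₀‖ - 1) / 2 with hδ
  have hδ0 : 0 < δ := by rw [hδ]; linarith
  have hlow : ∀ w ∈ ball w₀ δ, ∀ t, δ ≤ ‖G t - w * H t‖ := by
    intro w hw' t
    rw [norm_sub_rev]
    have h1 := norm_sub_norm_le (w * H t) (G t)
    rw [norm_mul, hb, mul_one] at h1
    have h2 : ‖w₀‖ - ‖w‖ ≤ ‖w₀ - w‖ := norm_sub_norm_le _ _
    rw [mem_ball', dist_eq_norm] at hw'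
    have := hG1 t
    linarith
  have hne : ∀ w ∈ ball w₀ δ, ∀ t, G t - w * H t ≠ 0 := fun w hw' t =>
    norm_pos_iff.1 (hδ0.trans_le (hlow w hw' t))
  have hw₀ : w₀ ∈ ball w₀ δ := mem_ball_self hδ0
  have hcF : ∀ w ∈ ball w₀ δ, Continuous fun t => F t / (G t - w * H t) := fun w hw' =>
    hF.div (by fun_prop) (hne w hw')
  have hcF' : Continuous fun t => F t * H t / (G t - w₀ * H t) ^ 2 :=
    (hF.mul hH).div (by fun_prop) fun t => pow_ne_zero 2 (hne w₀ hw₀ t)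
  refine (intervalIntegral.hasDerivAt_integral_of_dominated_loc_of_deriv_le
    (F' := fun w t => F t * H t / (G t - w * H t) ^ 2) (bound := fun t => ‖F t‖ / δ ^ 2)
    (isOpen_ball.mem_nhds hw₀) ?_ ((hcF w₀ hw₀).intervalIntegrable _ _)
    hcF'.aestronglyMeasurable ?_ ?_ ?_).2.differentiableAt
  · filter_upwards [isOpen_ball.mem_nhds hw₀] with w hw'
    exact (hcF w hw').aestronglyMeasurable
  · refine Eventually.of_forall fun t _ w hw' => ?_
    rw [norm_div, norm_mul, hb, mul_one, norm_pow]
    have := hlow w hw' t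
    gcongr
  · exact (hF.norm.div_const _).intervalIntegrable _ _
  · refine Eventually.of_forall fun t _ w hw' => ?_
    have h1 : HasDerivAt (fun w => G t - w * H t) (-(H t)) w := by
      simpa using ((hasDerivAt_id w).mul_const (H t)).const_sub (G t)
    exact ((hasDerivAt_const w (F t)).div h1 (hne w hw' t)).congr_deriv (by ring)

theorem differentiableOn_innerPowerSum {r p : ℕ} {a : ℤ → ℂ} (hr : 1 ≤ r) (h : CauchyStable r p a)
    (har : a (-(r : ℤ)) ≠ 0) (k : ℕ) :
    DifferentiableOn ℂ (innerPowerSum r p a k) {w | 1 < ‖w‖} := by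
  have hJ : DifferentiableOn ℂ (fun w => ∮ x in C(0, 1),
      powerSumNumerator r p a k x / (charPoly r p a w).eval x) {w | 1 < ‖w‖} := by
    intro w hw
    refine DifferentiableAt.differentiableWithinAt ?_
    have e : (fun w => ∮ x in C(0, 1),
        powerSumNumerator r p a k x / (charPoly r p a w).eval x) = fun w => ∫ t in 0..2 * Real.pi,
        deriv (circleMap 0 1) t * powerSumNumerator r p a k (circleMap 0 1 t) /
          ((charPoly r p a 0).eval (circleMap 0 1 t) - w * circleMap 0 1 t ^ r) := by
      funext w
      simp only [circleIntegral, smul_eq_mul, mul_div_assoc']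
      simp only [← charPoly_eval r p a w]
    rw [e]
    have hm : ∀ t, circleMap 0 1 t ∈ sphere (0 : ℂ) 1 := fun t =>
      circleMap_mem_sphere 0 zero_le_one t
    have hc := continuous_circleMap 0 1
    refine differentiableAt_integral_div ?_ ((Polynomial.continuous _).comp hc) (hc.pow r) ?_ ?_
      0 (2 * Real.pi) hw
    · have hd : Continuous (deriv (circleMap (0 : ℂ) 1)) := by
        rw [show deriv (circleMap (0 : ℂ) 1) = _ from funext (deriv_circleMap 0 1)]
        fun_prop
      exact hd.mul ((continuousOn_powerSumNumerator r p a k).comp_continuous hc hm)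
    · intro t
      have := hm t
      rw [mem_sphere_zero_iff_norm] at this
      rw [Pi.pow_apply, norm_pow, this, one_pow]
    · exact fun t => h.norm_eval_le (by simp)
  have h2 : (2 * Real.pi * Complex.I : ℂ) ≠ 0 := Complex.two_pi_I_ne_zero
  refine DifferentiableOn.congr (f := fun w => r * (0 : ℂ) ^ k + (2 * Real.pi * Complex.I)⁻¹ *
    ∮ x in C(0, 1), powerSumNumerator r p a k x / (charPoly r p a w).eval x)
    ((differentiableOn_const _).add (hJ.const_mul _)) fun w hw => ?_
  have := two_pi_I_mul_innerPowerSum hr h har k hw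
  field_simp
  linear_combination this

/-! ### The number of roots in the unit disk -/

theorem isPreconnected_exterior : IsPreconnected {w : ℂ | 1 < ‖w‖} := by
  have h : {w : ℂ | 1 < ‖w‖} = Complex.exp '' {s | 0 < s.re} := by
    ext w
    constructor
    · intro hw
      have hw0 : w ≠ 0 := norm_pos_iff.1 (zero_lt_one.trans hw)
      exact ⟨Complex.log w, by simpa [Complex.log_re] using Real.log_pos hw, Complex.exp_log hw0⟩
    · rintro ⟨s, hs, rfl⟩
      simpa [Complex.norm_exp] using hs
  rw [h]
  exact ((convex_halfSpace_re_gt 0).isPreconnected).image _ Complex.continuous_exp.continuousOn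

theorem isOpen_exterior : IsOpen {w : ℂ | 1 < ‖w‖} := isOpen_lt continuous_const continuous_norm

theorem innerPowerSum_zero (r p : ℕ) (a : ℤ → ℂ) (w : ℂ) :
    innerPowerSum r p a 0 w = (innerRoots r p a w).card := by
  simp [innerPowerSum]

/-- The count is the power sum of exponent `0`, hence continuous and integer-valued on a connected
set, so constant. For one large `w` the integral has modulus below `2π`, so the count differs from
`r` by less than `1`. -/
theorem card_innerRoots {r p : ℕ} {a : ℤ → ℂ} (hr : 1 ≤ r) (h : CauchyStable r p a)
    (har : a (-(r : ℤ)) ≠ 0) {w : ℂ} (hw : 1 < ‖w‖) : (innerRoots r p a w).card = r := by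
  obtain ⟨M, hM⟩ := (isCompact_sphere (0 : ℂ) 1).exists_bound_of_continuousOn
    (continuousOn_powerSumNumerator r p a 0)
  have hM0 : 0 ≤ M := (norm_nonneg _).trans (hM 1 (by simp))
  have hconst : ∀ w' : ℂ, 1 < ‖w'‖ → (innerRoots r p a w).card = (innerRoots r p a w').card := by
    intro w' hw'
    have hc : ContinuousOn (fun w => (innerRoots r p a w).card) {w | 1 < ‖w‖} := by
      rw [Nat.isClosedEmbedding_coe_real.isInducing.continuousOn_iff]
      refine (Complex.continuous_re.comp_continuousOn
        (differentiableOn_innerPowerSum hr h har 0).continuousOn).congr fun w _ => ?_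
      simp [innerPowerSum_zero]
    exact isPreconnected_exterior.constant hc hw hw'
  -- For this `w` one has `|P_w| ≥ M + 1` on the circle, so the integrand is at most `M / (M + 1) <
  -- 1`.
  have hM' : ‖((M + 2 : ℝ) : ℂ)‖ = M + 2 := by
    rw [Complex.norm_real, Real.norm_of_nonneg (by linarith)]
  have hw' : 1 < ‖((M + 2 : ℝ) : ℂ)‖ := by rw [hM']; linarith
  rw [hconst _ hw']
  set w' : ℂ := ((M + 2 : ℝ) : ℂ)
  have h1 := two_pi_I_mul_innerPowerSum hr h har 0 hw'
  have h2 : ‖∮ x in C(0, 1), powerSumNumerator r p a 0 x / (charPoly r p a w').eval x‖ ≤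
      2 * Real.pi * 1 * (M / (M + 1)) := by
    refine circleIntegral.norm_integral_le_of_norm_le_const zero_le_one fun x hx => ?_
    rw [norm_div]
    have hl := h.le_norm_eval (by simpa using hx : ‖x‖ = 1) w'
    rw [hM'] at hl
    exact div_le_div₀ hM0 (hM x hx) (by linarith) (by linarith)
  rw [innerPowerSum_zero, pow_zero, mul_one] at h1
  have h3 : (∮ x in C(0, 1), powerSumNumerator r p a 0 x / (charPoly r p a w').eval x) =
      2 * Real.pi * Complex.I * ((((innerRoots r p a w').card : ℤ) - r : ℤ) : ℂ) := by
    push_cast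
    linear_combination -h1
  rw [h3, norm_mul] at h2
  have h4 : ‖(2 * Real.pi * Complex.I : ℂ)‖ = 2 * Real.pi := by
    simp [abs_of_pos Real.pi_pos]
  rw [h4, Complex.norm_intCast, mul_one] at h2
  have h5 := le_of_mul_le_mul_left h2 (by positivity)
  have h6 : M / (M + 1) < 1 := by rw [div_lt_one (by linarith)]; linarith
  have h7 : |((innerRoots r p a w').card : ℤ) - r| < 1 := by
    have := h5.trans_lt h6
    exact_mod_cast this
  have := Int.abs_lt_one_iff.1 h7
  omega

theorem exists_enumeratesInnerRoots {r p : ℕ} {a : ℤ → ℂ} (hr : 1 ≤ r) (h : CauchyStable r p a)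
    (har : a (-(r : ℤ)) ≠ 0) {w : ℂ} (hw : 1 < ‖w‖) : ∃ κ, EnumeratesInnerRoots r p a w κ := by
  have hcard := card_innerRoots hr h har hw
  obtain ⟨l, hl⟩ := Quot.exists_rep (innerRoots r p a w)
  have hl' : (l : Multiset ℂ) = innerRoots r p a w := hl
  have hlen : l.length = r := by rw [← hcard, ← hl', Multiset.coe_card]
  subst hlen
  refine ⟨l.get, ?_⟩
  change _ = innerRoots _ p a w
  rw [← hl', Fin.univ_val_map, List.ofFn_get]

/-! ### Coefficients of the polynomial of the inner roots -/

theorem rootPoly_coeff_eq_esymm {r : ℕ} (κ : Fin r → ℂ) {i : ℕ} (hi : i ≤ r) :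
    (rootPoly κ).coeff i =
      (-1) ^ (r - i) * MvPolynomial.aeval κ (MvPolynomial.esymm (Fin r) ℂ (r - i)) := by
  have := Multiset.prod_X_sub_C_coeff (Finset.univ.val.map κ) (k := i) (by simpa using hi)
  rw [rootPoly_eq_multiset_prod, this, MvPolynomial.aeval_esymm_eq_multiset_esymm]
  simp

theorem continuous_rootPoly_coeff (r i : ℕ) :
    Continuous fun κ : Fin r → ℂ => (rootPoly κ).coeff i := by
  rcases le_or_gt i r with hi | hi
  · simp only [rootPoly_coeff_eq_esymm _ hi]
    refine continuous_const.mul ?_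
    simp only [MvPolynomial.aeval_eq_eval]
    exact MvPolynomial.continuous_eval _
  · have : (fun κ : Fin r → ℂ => (rootPoly κ).coeff i) = fun _ => 0 := by
      funext κ
      exact coeff_eq_zero_of_natDegree_lt (by rwa [rootPoly_natDegree])
    rw [this]
    exact continuous_const

/-- A choice of an enumeration of the inner roots. -/
def innerEnum (r p : ℕ) (a : ℤ → ℂ) (w : ℂ) : Fin r → ℂ :=
  open Classical in if h : ∃ κ, EnumeratesInnerRoots r p a w κ then h.choose else 0

theorem innerEnum_spec {r p : ℕ} {a : ℤ → ℂ} (hr : 1 ≤ r) (h : CauchyStable r p a)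
    (har : a (-(r : ℤ)) ≠ 0) {w : ℂ} (hw : 1 < ‖w‖) :
    EnumeratesInnerRoots r p a w (innerEnum r p a w) := by
  have hex := exists_enumeratesInnerRoots hr h har hw
  rw [innerEnum, dif_pos hex]
  exact hex.choose_spec

theorem EnumeratesInnerRoots.norm_lt {r p : ℕ} {a : ℤ → ℂ} {w : ℂ} {κ : Fin r → ℂ}
    (h : EnumeratesInnerRoots r p a w κ) (i : Fin r) : ‖κ i‖ < 1 := by
  have : κ i ∈ Finset.univ.val.map κ := Multiset.mem_map_of_mem _ (Finset.mem_univ i)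
  rw [h] at this
  exact (Multiset.mem_filter.1 this).2

theorem EnumeratesInnerRoots.eval_eq_zero {r p : ℕ} {a : ℤ → ℂ} {w : ℂ} {κ : Fin r → ℂ}
    (h : EnumeratesInnerRoots r p a w κ) (i : Fin r) : (charPoly r p a w).eval (κ i) = 0 := by
  have : κ i ∈ Finset.univ.val.map κ := Multiset.mem_map_of_mem _ (Finset.mem_univ i)
  rw [h] at this
  exact isRoot_of_mem_roots (Multiset.mem_filter.1 this).1

theorem EnumeratesInnerRoots.rootPoly_eq {r p : ℕ} {a : ℤ → ℂ} {w : ℂ} {κ κ' : Fin r → ℂ}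
    (h : EnumeratesInnerRoots r p a w κ) (h' : EnumeratesInnerRoots r p a w κ') :
    rootPoly κ = rootPoly κ' := by
  rw [rootPoly_eq_multiset_prod, rootPoly_eq_multiset_prod, h, h']

theorem EnumeratesInnerRoots.aeval_psum {r p : ℕ} {a : ℤ → ℂ} {w : ℂ} {κ : Fin r → ℂ}
    (h : EnumeratesInnerRoots r p a w κ) (k : ℕ) :
    MvPolynomial.aeval κ (MvPolynomial.psum (Fin r) ℂ k) = innerPowerSum r p a k w := by
  rw [innerPowerSum, innerRoots, ← h, Multiset.map_map, MvPolynomial.psum]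
  simp only [map_sum, map_pow, MvPolynomial.aeval_X]
  rfl

/-- Newton's identities give `k e_k` from the power sums and the `e_i` with `i < k`. The chosen
enumeration need not be continuous; only its symmetric functions are regular. -/
theorem differentiableOn_esymm_innerEnum {r p : ℕ} {a : ℤ → ℂ} (hr : 1 ≤ r)
    (h : CauchyStable r p a) (har : a (-(r : ℤ)) ≠ 0) (k : ℕ) :
    DifferentiableOn ℂ (fun w => MvPolynomial.aeval (innerEnum r p a w)
      (MvPolynomial.esymm (Fin r) ℂ k)) {w | 1 < ‖w‖} := by
  induction k using Nat.strong_induction_on with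
  | _ k ih =>
    rcases Nat.eq_zero_or_pos k with rfl | hk
    · simp
    have hk0 : (k : ℂ) ≠ 0 := by exact_mod_cast hk.ne'
    refine DifferentiableOn.congr (f := fun w => (k : ℂ)⁻¹ * ((-1) ^ (k + 1) *
      ∑ b ∈ (Finset.HasAntidiagonal.antidiagonal k).filter fun b => b.1 < k, (-1) ^ b.1 *
        MvPolynomial.aeval (innerEnum r p a w) (MvPolynomial.esymm (Fin r) ℂ b.1) *
          innerPowerSum r p a b.2 w)) ?_ ?_
    · refine DifferentiableOn.const_mul (DifferentiableOn.const_mul ?_ _) _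
      refine DifferentiableOn.fun_sum fun b hb => ?_
      exact ((ih b.1 (Finset.mem_filter.1 hb).2).const_mul _).mul
        (differentiableOn_innerPowerSum hr h har b.2)
    · intro w hw
      have hN := congrArg (MvPolynomial.aeval (innerEnum r p a w))
        (MvPolynomial.mul_esymm_eq_sum (Fin r) ℂ k)
      simp only [map_mul, map_natCast, map_pow, map_neg, map_one, map_sum,
        (innerEnum_spec hr h har hw).aeval_psum] at hN
      rw [← hN]
      field_simp

theorem differentiableOn_coeff_innerEnum {r p : ℕ} {a : ℤ → ℂ} (hr : 1 ≤ r)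
    (h : CauchyStable r p a) (har : a (-(r : ℤ)) ≠ 0) (i : ℕ) :
    DifferentiableOn ℂ (fun w => (rootPoly (innerEnum r p a w)).coeff i) {w | 1 < ‖w‖} := by
  rcases le_or_gt i r with hi | hi
  · simp only [rootPoly_coeff_eq_esymm _ hi]
    exact (differentiableOn_esymm_innerEnum hr h har _).const_mul _
  · have : (fun w => (rootPoly (innerEnum r p a w)).coeff i) = fun _ => 0 := by
      funext κ
      exact coeff_eq_zero_of_natDegree_lt (by rwa [rootPoly_natDegree])
    rw [this]
    exact differentiableOn_const _

/-- An inner root satisfies `w κ^r = P_0(κ)`, and `P_0` is bounded on the closed disk. -/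
theorem tendsto_innerEnum {r p : ℕ} {a : ℤ → ℂ} (hr : 1 ≤ r)
    (h : CauchyStable r p a) (har : a (-(r : ℤ)) ≠ 0) :
    Tendsto (innerEnum r p a) (Bornology.cobounded ℂ) (𝓝 0) := by
  obtain ⟨M, hM⟩ := (isCompact_closedBall (0 : ℂ) 1).exists_bound_of_continuousOn
    (Polynomial.continuous (charPoly r p a 0)).continuousOn
  rw [tendsto_pi_nhds]
  intro i
  have hpow : Tendsto (fun w => ‖innerEnum r p a w i‖ ^ r) (Bornology.cobounded ℂ) (𝓝 0) := by
    have hlim : Tendsto (fun w : ℂ => M / ‖w‖) (Bornology.cobounded ℂ) (𝓝 0) :=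
      tendsto_norm_cobounded_atTop.const_div_atTop M
    refine squeeze_zero' (Eventually.of_forall fun w => by positivity) ?_ hlim
    filter_upwards [tendsto_norm_cobounded_atTop.eventually_gt_atTop 1] with w hw
    have hs := innerEnum_spec hr h har hw
    have he := hs.eval_eq_zero i
    rw [charPoly_eval, sub_eq_zero] at he
    have hb := hM (innerEnum r p a w i) (by simpa using (hs.norm_lt i).le)
    rw [he, norm_mul, norm_pow] at hb
    rw [le_div_iff₀ (by linarith)]
    linarith
  rw [Metric.tendsto_nhds]
  intro ε hε
  filter_upwards [hpow.eventually_lt_const (pow_pos hε r)] with w hw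
  rw [Pi.zero_apply, dist_zero_right]
  exact lt_of_pow_lt_pow_left₀ r hε.le hw

/-! ### Limits of the inner roots at the unit circle -/

/-- A function whose cluster values along a filter form a finite set converges as soon as the filter
has arbitrarily small sets with connected image. -/
theorem exists_tendsto_of_finite_of_isPreconnected {α Y : Type*} [TopologicalSpace Y] [T2Space Y]
    {l : Filter α} [l.NeBot] {f : α → Y} {T : Set Y} (hT : T.Finite)
    (hconn : ∀ s ∈ l, ∃ N ∈ l, N ⊆ s ∧ IsPreconnected (f '' N))
    (hcl : ∀ u : Ultrafilter α, (u : Filter α) ≤ l → ∃ t ∈ T, Tendsto f u (𝓝 t)) :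
    ∃ t ∈ T, Tendsto f l (𝓝 t) := by
  classical
  obtain ⟨U, hU, hdisj⟩ := hT.t2_separation
  have hcover : ∀ V : Y → Set Y, (∀ t ∈ T, V t ∈ 𝓝 t) → {x | ∃ t ∈ T, f x ∈ V t} ∈ l := by
    intro V hV
    rw [mem_iff_ultrafilter]
    intro u hu
    obtain ⟨t, ht, htend⟩ := hcl u hu
    exact mem_of_superset (htend (hV t ht)) fun x hx => ⟨t, ht, hx⟩
  obtain ⟨N, hN, hNs, hNc⟩ := hconn _ (hcover U fun t _ => (hU t).2.mem_nhds (hU t).1)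
  obtain ⟨x₀, hx₀⟩ := nonempty_of_mem hN
  obtain ⟨t₀, ht₀, hfx₀⟩ := hNs hx₀
  have hsub : f '' N ⊆ U t₀ := by
    refine hNc.subset_left_of_subset_union (v := ⋃ t ∈ T \ {t₀}, U t) (hU t₀).2
      (isOpen_biUnion fun t _ => (hU t).2) ?_ ?_ ⟨f x₀, ⟨x₀, hx₀, rfl⟩, hfx₀⟩
    · rw [Set.disjoint_iUnion₂_right]
      exact fun t ht => hdisj ht₀ ht.1 (Ne.symm ht.2)
    · rintro _ ⟨x, hx, rfl⟩
      obtain ⟨t, ht, hft⟩ := hNs hx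
      by_cases h : t = t₀
      · exact Or.inl (h ▸ hft)
      · exact Or.inr (Set.mem_biUnion (⟨ht, h⟩ : t ∈ T \ {t₀}) hft)
  refine ⟨t₀, ht₀, fun V hV => ?_⟩
  -- Shrinking only the neighbourhood of `t₀` to `V` still gives an eventual cover, and on `N` the
  -- other sets `U t` are excluded by disjointness.
  have h1 := hcover (fun t => if t = t₀ then V else U t) fun t _ => by
    by_cases h : t = t₀
    · simpa [h] using hV
    · simpa [h] using (hU t).2.mem_nhds (hU t).1
  rw [Filter.mem_map]
  filter_upwards [h1, hN] with x hx hxN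
  obtain ⟨t, ht, hft⟩ := hx
  by_cases h : t = t₀
  · simpa [h] using hft
  · simp only [h, if_false] at hft
    exact absurd (hsub ⟨x, hxN, rfl⟩) (Set.disjoint_left.1 (hdisj ht ht₀ h) hft)

/-- In the coordinate `t = log (w / z)` the exterior near `z` becomes a right half-plane, where
half-balls are convex. -/
theorem exists_isPreconnected_nhdsWithin_exterior {z : ℂ} (hz : ‖z‖ = 1) {s : Set ℂ}
    (hs : s ∈ 𝓝[{w : ℂ | 1 < ‖w‖}] z) :
    ∃ N ∈ 𝓝[{w : ℂ | 1 < ‖w‖}] z, N ⊆ s ∧ N ⊆ {w : ℂ | 1 < ‖w‖} ∧ IsPreconnected N := by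
  have hz0 : z ≠ 0 := norm_pos_iff.1 (by linarith)
  have hcont : Continuous fun t : ℂ => z * Complex.exp t := by fun_prop
  have hmaps : ∀ t : ℂ, 0 < t.re → 1 < ‖z * Complex.exp t‖ := fun t ht => by
    rw [norm_mul, hz, one_mul, Complex.norm_exp]
    simpa using ht
  have htend : Tendsto (fun t : ℂ => z * Complex.exp t) (𝓝[{t : ℂ | 0 < t.re}] 0)
      (𝓝[{w : ℂ | 1 < ‖w‖}] z) := by
    refine tendsto_nhdsWithin_iff.2 ⟨?_, eventually_nhdsWithin_of_forall hmaps⟩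
    simpa using (hcont.tendsto 0).mono_left nhdsWithin_le_nhds
  obtain ⟨δ, hδ, hball⟩ := Metric.mem_nhdsWithin_iff.1 (htend hs)
  refine ⟨(fun t : ℂ => z * Complex.exp t) '' (ball 0 δ ∩ {t | 0 < t.re}), ?_, ?_, ?_, ?_⟩
  · have hlog : Tendsto (fun w => Complex.log (w / z)) (𝓝[{w : ℂ | 1 < ‖w‖}] z) (𝓝 0) := by
      have hca : ContinuousAt (fun w => Complex.log (w / z)) z := by
        refine ContinuousAt.clog (by fun_prop) ?_
        rw [div_self hz0]
        exact Complex.one_mem_slitPlane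
      have := hca.tendsto.mono_left (nhdsWithin_le_nhds (s := {w : ℂ | 1 < ‖w‖}))
      simpa [div_self hz0] using this
    filter_upwards [hlog (ball_mem_nhds 0 hδ), self_mem_nhdsWithin] with w hw1 hw2
    have hw2' : 1 < ‖w‖ := hw2
    have hw0 : w / z ≠ 0 := div_ne_zero (norm_pos_iff.1 (zero_lt_one.trans hw2')) hz0
    refine ⟨Complex.log (w / z), ⟨hw1, ?_⟩, ?_⟩
    · change 0 < (Complex.log (w / z)).re
      rw [Complex.log_re, norm_div, hz, div_one]
      exact Real.log_pos hw2'
    · simp only [Complex.exp_log hw0]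
      field_simp
  · rintro _ ⟨t, ht, rfl⟩
    exact hball ht
  · rintro _ ⟨t, ht, rfl⟩
    exact hmaps t ht.2
  · exact (((convex_ball 0 δ).inter (convex_halfSpace_re_gt 0)).isPreconnected).image _
      hcont.continuousOn

theorem exists_perm_of_rootPoly_eq {r : ℕ} {κ κ' : Fin r → ℂ} (h : rootPoly κ = rootPoly κ') :
    ∃ σ : Equiv.Perm (Fin r), ∀ i, κ' (σ i) = κ i := by
  have hm : Finset.univ.val.map κ = Finset.univ.val.map κ' := by
    rw [← rootPoly_roots, ← rootPoly_roots, h]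
  have hc : ∀ c, Nonempty ({i // κ i = c} ≃ {i // κ' i = c}) := fun c => by
    rw [← Fintype.card_eq, Fintype.card_subtype, Fintype.card_subtype, card_filter_eq_count,
      card_filter_eq_count, hm]
  exact ⟨Equiv.ofFiberEquiv fun c => (hc c).some, fun i => Equiv.ofFiberEquiv_map _ i⟩

theorem EnumeratesInnerRoots.comp_perm {r p : ℕ} {a : ℤ → ℂ} {w : ℂ} {κ : Fin r → ℂ}
    (h : EnumeratesInnerRoots r p a w κ) (σ : Equiv.Perm (Fin r)) :
    EnumeratesInnerRoots r p a w (κ ∘ σ) := by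
  rw [EnumeratesInnerRoots, ← h, ← Multiset.map_map, Multiset.map_univ_val_equiv]

/-- The coefficients of the polynomial of the inner roots. -/
def innerCoeff (r p : ℕ) (a : ℤ → ℂ) (w : ℂ) : ℕ → ℂ := (rootPoly (innerEnum r p a w)).coeff

theorem continuous_rootPoly_coeff_pi (r : ℕ) :
    Continuous fun κ : Fin r → ℂ => (rootPoly κ).coeff :=
  continuous_pi fun i => continuous_rootPoly_coeff r i

/-- Compactness of the polydisk gives a limit of the ordered tuple along an ultrafilter, although
the enumeration is arbitrary; the equation `P_w(κ) = 0` passes to the limit. -/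
theorem exists_tendsto_innerEnum_ultrafilter {r p : ℕ} {a : ℤ → ℂ} (hr : 1 ≤ r)
    (h : CauchyStable r p a) (har : a (-(r : ℤ)) ≠ 0) {z : ℂ} (u : Ultrafilter ℂ)
    (hu : (u : Filter ℂ) ≤ 𝓝[{w : ℂ | 1 < ‖w‖}] z) :
    ∃ κ : Fin r → ℂ, Tendsto (innerEnum r p a) u (𝓝 κ) ∧
      ∀ i, (charPoly r p a z).eval (κ i) = 0 := by
  have hmem : ∀ᶠ w in (u : Filter ℂ), 1 < ‖w‖ := hu self_mem_nhdsWithin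
  obtain ⟨κ, -, hκ⟩ := (isCompact_closedBall (0 : Fin r → ℂ) 1).ultrafilter_le_nhds
    (u.map (innerEnum r p a)) (by
      rw [le_principal_iff, Ultrafilter.coe_map, Filter.mem_map]
      filter_upwards [hmem] with w hw
      rw [Set.mem_preimage, mem_closedBall_zero_iff, pi_norm_le_iff_of_nonneg zero_le_one]
      exact fun i => ((innerEnum_spec hr h har hw).norm_lt i).le)
  have hκ' : Tendsto (innerEnum r p a) u (𝓝 κ) := hκ
  refine ⟨κ, hκ', fun i => ?_⟩
  have hi := (tendsto_pi_nhds.1 hκ') i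
  have hid : Tendsto (fun w : ℂ => w) u (𝓝 z) := hu.trans nhdsWithin_le_nhds
  have hlim : Tendsto (fun w => (charPoly r p a 0).eval (innerEnum r p a w i) -
      w * innerEnum r p a w i ^ r) u (𝓝 ((charPoly r p a z).eval (κ i))) := by
    rw [charPoly_eval]
    exact (((Polynomial.continuous _).tendsto _).comp hi).sub (hid.mul (hi.pow r))
  refine tendsto_nhds_unique hlim (tendsto_const_nhds.congr' ?_)
  filter_upwards [hmem] with w hw
  rw [← charPoly_eval, (innerEnum_spec hr h har hw).eval_eq_zero i]

theorem neBot_nhdsWithin_exterior {z : ℂ} (hz : 1 ≤ ‖z‖) : (𝓝[{w : ℂ | 1 < ‖w‖}] z).NeBot := by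
  have hz0 : z ≠ 0 := norm_pos_iff.1 (by linarith)
  rw [← mem_closure_iff_nhdsWithin_neBot, Metric.mem_closure_iff]
  intro ε hε
  have hn : 0 < ‖z‖ := by linarith
  refine ⟨z * (1 + (ε / (2 * ‖z‖) : ℝ)), ?_, ?_⟩
  · have hpos : 0 < ε / (2 * ‖z‖) := by positivity
    have : ‖(1 + (ε / (2 * ‖z‖) : ℝ) : ℂ)‖ = 1 + ε / (2 * ‖z‖) := by
      rw [← Complex.ofReal_one, ← Complex.ofReal_add, Complex.norm_real,
        Real.norm_of_nonneg (by linarith)]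
    change 1 < ‖z * _‖
    rw [norm_mul, this]
    nlinarith
  · rw [dist_eq_norm, show z - z * (1 + (ε / (2 * ‖z‖) : ℝ)) = -(z * ((ε / (2 * ‖z‖) : ℝ) : ℂ)) by
      ring, norm_neg, norm_mul, Complex.norm_real, Real.norm_of_nonneg (by positivity)]
    field_simp
    linarith

theorem exists_tendsto_innerCoeff {r p : ℕ} {a : ℤ → ℂ} (hr : 1 ≤ r)
    (h : CauchyStable r p a) (har : a (-(r : ℤ)) ≠ 0) {z : ℂ} (hz : ‖z‖ = 1) :
    ∃ κ : Fin r → ℂ, (∀ i, (charPoly r p a z).eval (κ i) = 0) ∧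
      Tendsto (innerCoeff r p a) (𝓝[{w : ℂ | 1 < ‖w‖}] z) (𝓝 (rootPoly κ).coeff) := by
  have := neBot_nhdsWithin_exterior hz.ge
  have hfin : {κ : Fin r → ℂ | ∀ i, (charPoly r p a z).eval (κ i) = 0}.Finite := by
    have h1 : {x : ℂ | (charPoly r p a z).eval x = 0}.Finite := by
      refine (charPoly r p a z).roots.toFinset.finite_toSet.subset fun x hx => ?_
      simpa [charPoly_ne_zero p hr har z] using hx
    exact Set.Finite.pi' fun _ => h1
  have hconn : ∀ s ∈ 𝓝[{w : ℂ | 1 < ‖w‖}] z, ∃ N ∈ 𝓝[{w : ℂ | 1 < ‖w‖}] z, N ⊆ s ∧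
      IsPreconnected (innerCoeff r p a '' N) := by
    intro s hs
    obtain ⟨N, hN, hNs, hNU, hNc⟩ := exists_isPreconnected_nhdsWithin_exterior hz hs
    refine ⟨N, hN, hNs, hNc.image _ ?_⟩
    exact (continuousOn_pi.2 fun i =>
      (differentiableOn_coeff_innerEnum hr h har i).continuousOn).mono hNU
  obtain ⟨_, ⟨κ, hκ, rfl⟩, ht⟩ := exists_tendsto_of_finite_of_isPreconnected
    (hfin.image fun κ => (rootPoly κ).coeff) hconn fun u hu => by
      obtain ⟨κ, hκ, hroot⟩ := exists_tendsto_innerEnum_ultrafilter hr h har u hu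
      exact ⟨_, ⟨κ, hroot, rfl⟩, ((continuous_rootPoly_coeff_pi r).tendsto κ).comp hκ⟩
  exact ⟨κ, hκ, ht⟩

/-- Along each ultrafilter the ordered inner roots converge to a tuple with the same polynomial as
`κ`, hence to a permutation of `κ`; reordering gives closeness entry by entry. -/
theorem isStableRoots_of_tendsto {r p : ℕ} {a : ℤ → ℂ} (hr : 1 ≤ r)
    (h : CauchyStable r p a) (har : a (-(r : ℤ)) ≠ 0) {z : ℂ} (hz : ‖z‖ = 1) {κ : Fin r → ℂ}
    (hκ : Tendsto (innerCoeff r p a) (𝓝[{w : ℂ | 1 < ‖w‖}] z) (𝓝 (rootPoly κ).coeff)) :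
    IsStableRoots r p a z κ := by
  refine Or.inr ⟨hz, fun ε hε => ?_⟩
  have hev : {w | ∃ κ' : Fin r → ℂ, EnumeratesInnerRoots r p a w κ' ∧ ∀ i, ‖κ' i - κ i‖ < ε} ∈
      𝓝[{w : ℂ | 1 < ‖w‖}] z := by
    rw [mem_iff_ultrafilter]
    intro u hu
    obtain ⟨κ₁, hκ₁, -⟩ := exists_tendsto_innerEnum_ultrafilter hr h har u hu
    have heq : rootPoly κ₁ = rootPoly κ := by
      ext i
      exact congrFun (tendsto_nhds_unique (((continuous_rootPoly_coeff_pi r).tendsto κ₁).comp hκ₁)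
        (hκ.mono_left hu)) i
    obtain ⟨σ, hσ⟩ := exists_perm_of_rootPoly_eq heq
    filter_upwards [hκ₁ (ball_mem_nhds κ₁ hε), hu self_mem_nhdsWithin] with w hw hw1
    refine ⟨innerEnum r p a w ∘ σ.symm, (innerEnum_spec hr h har hw1).comp_perm _, fun i => ?_⟩
    rw [← σ.apply_symm_apply i, hσ, Function.comp_apply, σ.symm_apply_apply]
    rw [Set.mem_preimage, mem_ball, dist_eq_norm] at hw
    exact (norm_le_pi_norm (innerEnum r p a w - κ₁) (σ.symm i)).trans_lt hw
  obtain ⟨δ, hδ, hball⟩ := Metric.mem_nhdsWithin_iff.1 hev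
  exact ⟨δ, hδ, fun w hw hwz => hball ⟨by rwa [mem_ball, dist_eq_norm], hw⟩⟩

theorem IsStableRoots.tendsto {r p : ℕ} {a : ℤ → ℂ} (hr : 1 ≤ r)
    (h : CauchyStable r p a) (har : a (-(r : ℤ)) ≠ 0) {z : ℂ} (hz : ‖z‖ = 1) {κ : Fin r → ℂ}
    (hκ : IsStableRoots r p a z κ) :
    Tendsto (innerCoeff r p a) (𝓝[{w : ℂ | 1 < ‖w‖}] z) (𝓝 (rootPoly κ).coeff) := by
  rcases hκ with hκ | ⟨-, hκ⟩
  · exact absurd hz hκ.1.ne'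
  intro V hV
  obtain ⟨ε, hε, hball⟩ := Metric.mem_nhds_iff.1
    ((continuous_rootPoly_coeff_pi r).continuousAt (x := κ) hV)
  obtain ⟨δ, hδ, hw⟩ := hκ ε hε
  rw [Filter.mem_map, Metric.mem_nhdsWithin_iff]
  refine ⟨δ, hδ, fun w ⟨hwz, hw1⟩ => ?_⟩
  obtain ⟨κ', hκ', hclose⟩ := hw w hw1 (by rwa [← dist_eq_norm])
  rw [Set.mem_preimage, innerCoeff, (innerEnum_spec hr h har hw1).rootPoly_eq hκ']
  refine hball ?_
  rw [mem_ball, dist_eq_norm, pi_norm_lt_iff hε]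
  exact hclose

/-- The default value in `stableRoots` is never taken on the closed exterior. -/
theorem isStableRoots_stableRoots {r p : ℕ} {a : ℤ → ℂ} (hr : 1 ≤ r)
    (h : CauchyStable r p a) (har : a (-(r : ℤ)) ≠ 0) {z : ℂ} (hz : 1 ≤ ‖z‖) :
    IsStableRoots r p a z (stableRoots r p a z) := by
  have hex : ∃ κ, IsStableRoots r p a z κ := by
    rcases hz.lt_or_eq with hz | hz
    · exact ⟨_, Or.inl ⟨hz, innerEnum_spec hr h har hz⟩⟩
    · obtain ⟨κ, -, hκ⟩ := exists_tendsto_innerCoeff hr h har hz.symm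
      exact ⟨κ, isStableRoots_of_tendsto hr h har hz.symm hκ⟩
  rw [stableRoots, dif_pos hex]
  exact hex.choose_spec

/-! ### Regularity of the stable polynomial on the closed exterior. -/

/-- The coefficients of the polynomial of the stable roots. -/
def stableCoeff (r p : ℕ) (a : ℤ → ℂ) (z : ℂ) : ℕ → ℂ := (rootPoly (stableRoots r p a z)).coeff

theorem stableCoeff_eq_innerCoeff {r p : ℕ} {a : ℤ → ℂ} (hr : 1 ≤ r)
    (h : CauchyStable r p a) (har : a (-(r : ℤ)) ≠ 0) {z : ℂ} (hz : 1 < ‖z‖) :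
    stableCoeff r p a z = innerCoeff r p a z := by
  rcases isStableRoots_stableRoots hr h har hz.le with hs | hs
  · rw [stableCoeff, innerCoeff, hs.2.rootPoly_eq (innerEnum_spec hr h har hz)]
  · exact absurd hs.1 hz.ne'

theorem stableRoots_ne_zero {r p : ℕ} {a : ℤ → ℂ} (hr : 1 ≤ r)
    (h : CauchyStable r p a) (har : a (-(r : ℤ)) ≠ 0) {z : ℂ} (hz : 1 ≤ ‖z‖) (i : Fin r) :
    stableRoots r p a z i ≠ 0 := by
  have hs := isStableRoots_stableRoots hr h har hz
  rcases hz.lt_or_eq with hz | hz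
  · rcases hs with hs | hs
    · exact ne_zero_of_isRoot_charPoly hr har (hs.2.eval_eq_zero i)
    · exact absurd hs.1 hz.ne'
  · obtain ⟨κ, hroot, hκ⟩ := exists_tendsto_innerCoeff hr h har hz.symm
    have := neBot_nhdsWithin_exterior hz.le
    have heq : rootPoly (stableRoots r p a z) = rootPoly κ := by
      ext j
      exact congrFun (tendsto_nhds_unique (hs.tendsto hr h har hz.symm) hκ) j
    obtain ⟨σ, hσ⟩ := exists_perm_of_rootPoly_eq heq
    rw [← hσ]
    exact ne_zero_of_isRoot_charPoly hr har (hroot _)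

theorem differentiableOn_stableCoeff {r p : ℕ} {a : ℤ → ℂ} (hr : 1 ≤ r)
    (h : CauchyStable r p a) (har : a (-(r : ℤ)) ≠ 0) (i : ℕ) :
    DifferentiableOn ℂ (fun z => stableCoeff r p a z i) {z | 1 < ‖z‖} :=
  (differentiableOn_coeff_innerEnum hr h har i).congr fun z hz => by
    rw [stableCoeff_eq_innerCoeff hr h har hz]; rfl

/-- The values on the circle are limits from the open exterior, so the function is the continuous
extension by limits (`extendFrom`) of `innerCoeff`. -/
theorem continuousOn_stableCoeff {r p : ℕ} {a : ℤ → ℂ} (hr : 1 ≤ r)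
    (h : CauchyStable r p a) (har : a (-(r : ℤ)) ≠ 0) :
    ContinuousOn (stableCoeff r p a) {z | 1 ≤ ‖z‖} := by
  have hcl : {z : ℂ | 1 ≤ ‖z‖} ⊆ closure {z : ℂ | 1 < ‖z‖} := fun z hz =>
    mem_closure_iff_nhdsWithin_neBot.2 (neBot_nhdsWithin_exterior hz)
  have htend : ∀ z ∈ {z : ℂ | 1 ≤ ‖z‖}, Tendsto (innerCoeff r p a) (𝓝[{w : ℂ | 1 < ‖w‖}] z)
      (𝓝 (stableCoeff r p a z)) := by
    intro z hz
    rcases (show 1 ≤ ‖z‖ from hz).lt_or_eq with hz' | hz'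
    · rw [stableCoeff_eq_innerCoeff hr h har hz']
      exact (continuousOn_pi.2 fun i =>
        (differentiableOn_coeff_innerEnum hr h har i).continuousOn) z hz'
    · exact (isStableRoots_stableRoots hr h har hz).tendsto hr h har hz'.symm
  exact (continuousOn_extendFrom hcl fun z hz => ⟨_, htend z hz⟩).congr fun z hz =>
    (extendFrom_eq (hcl hz) (htend z hz)).symm

theorem tendsto_stableCoeff {r p : ℕ} {a : ℤ → ℂ} (hr : 1 ≤ r)
    (h : CauchyStable r p a) (har : a (-(r : ℤ)) ≠ 0) :
    Tendsto (stableCoeff r p a) (Bornology.cobounded ℂ) (𝓝 (X ^ r : ℂ[X]).coeff) := by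
  have h0 : (rootPoly (0 : Fin r → ℂ)) = X ^ r := by simp [rootPoly]
  have := ((continuous_rootPoly_coeff_pi r).tendsto 0).comp (tendsto_innerEnum hr h har)
  rw [h0] at this
  refine this.congr' ?_
  filter_upwards [tendsto_norm_cobounded_atTop.eventually_gt_atTop 1] with w hw
  rw [stableCoeff_eq_innerCoeff hr h har hw]
  rfl

/-! ### Regularity of the intrinsic determinant -/

theorem continuous_remCoeff (r j i : ℕ) : Continuous fun q : ℕ → ℂ => remCoeff r q j i := by
  induction j generalizing i with
  | zero => exact continuous_const
  | succ j ih =>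
    rcases i with _ | i
    · exact ((ih _).mul (continuous_apply 0)).neg
    · exact (ih _).sub ((ih _).mul (continuous_apply _))

theorem differentiableOn_remCoeff {s : Set ℂ} {q : ℂ → ℕ → ℂ}
    (hq : ∀ i, DifferentiableOn ℂ (fun z => q z i) s) (r j i : ℕ) :
    DifferentiableOn ℂ (fun z => remCoeff r (q z) j i) s := by
  induction j generalizing i with
  | zero => exact differentiableOn_const _
  | succ j ih =>
    rcases i with _ | i
    · exact ((ih _).mul (hq 0)).neg
    · exact (ih _).sub ((ih _).mul (hq _))

theorem continuous_remMatrix (n r : ℕ) : Continuous (remMatrix n r) :=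
  continuous_matrix fun j i => continuous_remCoeff r j i

theorem intrinsicDet_eq {r p m : ℕ} {a : ℤ → ℂ} (hr : 1 ≤ r) (h : CauchyStable r p a)
    (har : a (-(r : ℤ)) ≠ 0) (B : Matrix (Fin r) (Fin m) ℂ) {z : ℂ} (hz : 1 ≤ ‖z‖) :
    intrinsicDet r p m a B z = (z • (1 : Matrix (Fin r) (Fin r) ℂ) -
      boundaryMatrix r p m a B * remMatrix m r (stableCoeff r p a z)).det :=
  det_basisMatrix_quotient hr _ (stableRoots_ne_zero hr h har hz) z _

theorem continuousOn_intrinsicDet {r p m : ℕ} {a : ℤ → ℂ} (hr : 1 ≤ r) (h : CauchyStable r p a)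
    (har : a (-(r : ℤ)) ≠ 0) (B : Matrix (Fin r) (Fin m) ℂ) :
    ContinuousOn (intrinsicDet r p m a B) {z | 1 ≤ ‖z‖} := by
  have hD : Continuous fun x : ℂ × (ℕ → ℂ) => (x.1 • (1 : Matrix (Fin r) (Fin r) ℂ) -
      boundaryMatrix r p m a B * remMatrix m r x.2).det :=
    ((continuous_fst.smul continuous_const).sub (continuous_const.matrix_mul
      ((continuous_remMatrix m r).comp continuous_snd))).matrix_det
  exact (hD.comp_continuousOn (continuousOn_id.prodMk (continuousOn_stableCoeff hr h har))).congr
    fun z hz => intrinsicDet_eq hr h har B hz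

theorem differentiableOn_intrinsicDet {r p m : ℕ} {a : ℤ → ℂ} (hr : 1 ≤ r) (h : CauchyStable r p a)
    (har : a (-(r : ℤ)) ≠ 0) (B : Matrix (Fin r) (Fin m) ℂ) :
    DifferentiableOn ℂ (intrinsicDet r p m a B) {z | 1 < ‖z‖} := by
  refine DifferentiableOn.congr ?_ fun z hz => intrinsicDet_eq hr h har B (le_of_lt hz)
  simp only [Matrix.det_apply]
  refine DifferentiableOn.fun_sum fun σ _ => DifferentiableOn.const_smul ?_ _
  refine DifferentiableOn.fun_finsetProd fun i _ => ?_
  simp only [Matrix.sub_apply, Matrix.smul_apply, smul_eq_mul, Matrix.mul_apply]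
  refine (differentiableOn_id.mul_const _).sub (DifferentiableOn.fun_sum fun j _ => ?_)
  exact (differentiableOn_remCoeff (differentiableOn_stableCoeff hr h har) r j i).const_mul _

/-- The quotient is `det (1 - z⁻¹ 𝓑 R)`, jointly continuous in `z⁻¹` and the coefficients, which
tend to `0` and to those of `X^r`. -/
theorem tendsto_intrinsicDet {r p m : ℕ} {a : ℤ → ℂ} (hr : 1 ≤ r) (h : CauchyStable r p a)
    (har : a (-(r : ℤ)) ≠ 0) (B : Matrix (Fin r) (Fin m) ℂ) :
    Tendsto (fun z => intrinsicDet r p m a B z / z ^ r) (Bornology.cobounded ℂ) (𝓝 1) := by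
  have hD : Continuous fun x : ℂ × (ℕ → ℂ) => ((1 : Matrix (Fin r) (Fin r) ℂ) -
      x.1 • (boundaryMatrix r p m a B * remMatrix m r x.2)).det :=
    (continuous_const.sub (continuous_fst.smul (continuous_const.matrix_mul
      ((continuous_remMatrix m r).comp continuous_snd)))).matrix_det
  have hlim := (hD.tendsto (0, (X ^ r : ℂ[X]).coeff)).comp
    ((tendsto_inv₀_cobounded (α := ℂ)).prodMk_nhds (tendsto_stableCoeff hr h har))
  simp only [zero_smul, sub_zero, Matrix.det_one] at hlim
  refine hlim.congr' ?_
  filter_upwards [tendsto_norm_cobounded_atTop.eventually_gt_atTop 1] with z hz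
  have hz0 : z ≠ 0 := norm_pos_iff.1 (zero_lt_one.trans hz)
  have hfac : z • (1 : Matrix (Fin r) (Fin r) ℂ) -
      boundaryMatrix r p m a B * remMatrix m r (stableCoeff r p a z) =
      z • (1 - z⁻¹ • (boundaryMatrix r p m a B * remMatrix m r (stableCoeff r p a z))) := by
    rw [smul_sub, smul_smul, mul_inv_cancel₀ hz0, one_smul]
  rw [intrinsicDet_eq hr h har B hz.le, hfac, Matrix.det_smul, Fintype.card_fin,
    mul_div_cancel_left₀ _ (pow_ne_zero r hz0)]
  rfl

/-! ### The argument principle in the exterior of the unit disk -/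

/-- The exponential is a covering of the punctured plane, and the plane is simply connected, so `g`
lifts. -/
theorem exists_continuous_log {g : ℂ → ℂ} (hg : Continuous g) (h0 : ∀ z, g z ≠ 0) :
    ∃ L : ℂ → ℂ, Continuous L ∧ ∀ z, Complex.exp (L z) = g z := by
  obtain ⟨L, ⟨-, hL⟩, -⟩ := Complex.isCoveringMapOn_exp.existsUnique_continuousMap_lifts
    ⟨g, hg⟩ (a₀ := (0 : ℂ)) (Complex.exp_log (h0 0)) h0
  exact ⟨L, L.continuous, fun z => congrFun hL z⟩

theorem exists_continuous_log_closedBall {g : ℂ → ℂ} (hg : ContinuousOn g (closedBall 0 1))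
    (h0 : ∀ z ∈ closedBall (0 : ℂ) 1, g z ≠ 0) :
    ∃ L : ℂ → ℂ, Continuous L ∧ ∀ z ∈ closedBall (0 : ℂ) 1, Complex.exp (L z) = g z := by
  -- The radial retraction onto the closed disk extends `g` to the whole plane without creating
  -- zeros.
  set ρ : ℂ → ℂ := fun z => z / ((max 1 ‖z‖ : ℝ) : ℂ) with hρ
  have hpos : ∀ z : ℂ, 0 < max 1 ‖z‖ := fun z => zero_lt_one.trans_le (le_max_left _ _)
  have hρc : Continuous ρ := continuous_id.div (by fun_prop) fun z => by
    exact_mod_cast (hpos z).ne'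
  have hρm : ∀ z, ρ z ∈ closedBall (0 : ℂ) 1 := fun z => by
    rw [mem_closedBall_zero_iff, hρ, norm_div, Complex.norm_real, Real.norm_of_nonneg (hpos z).le,
      div_le_one (hpos z)]
    exact le_max_right _ _
  obtain ⟨L, hLc, hL⟩ := exists_continuous_log (hg.comp_continuous hρc hρm) fun z => h0 _ (hρm z)
  refine ⟨L, hLc, fun z hz => ?_⟩
  rw [mem_closedBall_zero_iff] at hz
  rw [hL, Function.comp_apply, hρ]
  simp [max_eq_left hz]

/-- Write `x - s = -s (1 - x/s)`; the second factor stays in the disk of radius `1` about `1`, where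
the principal logarithm is continuous. -/
theorem exists_log_exp_sub {s : ℂ} (hs : 1 < ‖s‖) :
    ∃ ℓ : ℂ → ℂ, ContinuousOn ℓ (sphere 0 1) ∧ ∀ x ∈ sphere (0 : ℂ) 1, Complex.exp (ℓ x) = x - s := by
  have hs0 : s ≠ 0 := norm_pos_iff.1 (zero_lt_one.trans hs)
  have hmem : ∀ x ∈ sphere (0 : ℂ) 1, 1 - x / s ∈ Complex.slitPlane := fun x hx => by
    rw [sub_eq_add_neg]
    refine Complex.mem_slitPlane_of_norm_lt_one ?_
    rw [mem_sphere_zero_iff_norm] at hx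
    rw [norm_neg, norm_div, hx, div_lt_one (by linarith)]
    exact hs
  refine ⟨fun x => Complex.log (-s) + Complex.log (1 - x / s), ?_, fun x hx => ?_⟩
  · exact continuousOn_const.add (ContinuousOn.clog (by fun_prop) hmem)
  · rw [Complex.exp_add, Complex.exp_log (neg_ne_zero.2 hs0),
      Complex.exp_log (Complex.slitPlane_ne_zero (hmem x hx))]
    field_simp
    ring

theorem windingNumber_eq {c : ℝ → ℂ} {z₀ : ℂ} {w : ℤ} (h : HasWindingNumber c z₀ w) :
    windingNumber c z₀ = w := by
  have hex : ∃ w, HasWindingNumber c z₀ w := ⟨w, h⟩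
  rw [windingNumber, dif_pos hex]
  exact hex.choose_spec.unique h

theorem hasWindingNumber_of_factorization {f G : ℂ → ℂ} {r : ℕ} {S : Finset ℂ} {n : ℂ → ℕ}
    (hS : ∀ s ∈ S, 1 < ‖s‖) (hG : ContinuousOn G {z | 1 ≤ ‖z‖})
    (hG0 : ∀ z, 1 ≤ ‖z‖ → G z ≠ 0)
    (hfac : ∀ z, 1 ≤ ‖z‖ → f z = (∏ s ∈ S, (z - s) ^ n s) * G z)
    (hinf : Tendsto (fun z => f z / z ^ r) (Bornology.cobounded ℂ) (𝓝 1)) :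
    HasWindingNumber (fun θ : ℝ => f (Complex.exp (Complex.I * (θ : ℂ)))) 0
      ((r : ℤ) - ∑ s ∈ S, (n s : ℤ)) := by
  set N : ℤ := (r : ℤ) - ∑ s ∈ S, (n s : ℤ) with hN
  have hGinf : Tendsto (fun z => G z * z ^ (-N)) (Bornology.cobounded ℂ) (𝓝 1) := by
    have h1 : Tendsto (fun z : ℂ => ∏ s ∈ S, (1 - s * z⁻¹) ^ n s) (Bornology.cobounded ℂ)
        (𝓝 1) := by
      have : Tendsto (fun z : ℂ => ∏ s ∈ S, (1 - s * z⁻¹) ^ n s) (Bornology.cobounded ℂ)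
          (𝓝 (∏ s ∈ S, (1 - s * 0) ^ n s)) :=
        tendsto_finsetProd _ fun s _ =>
          (tendsto_const_nhds.sub (tendsto_inv₀_cobounded.const_mul s)).pow _
      simpa using this
    have h2 := hinf.div h1 one_ne_zero
    rw [div_one] at h2
    refine h2.congr' ?_
    have hne : ∀ᶠ z : ℂ in Bornology.cobounded ℂ, ∀ s ∈ S, z ≠ s :=
      (Finset.eventually_all S).2 fun s _ =>
        (tendsto_norm_cobounded_atTop.eventually_gt_atTop ‖s‖).mono fun z hz h => by
          rw [h] at hz; exact lt_irrefl _ hz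
    filter_upwards [tendsto_norm_cobounded_atTop.eventually_gt_atTop 1, hne] with z hz hzS
    have hz0 : z ≠ 0 := norm_pos_iff.1 (zero_lt_one.trans hz)
    have hP : ∏ s ∈ S, (z - s) ^ n s ≠ 0 :=
      Finset.prod_ne_zero_iff.2 fun s hs => pow_ne_zero _ (sub_ne_zero.2 (hzS s hs))
    have hQ : ∏ s ∈ S, (1 - s * z⁻¹) ^ n s = (∏ s ∈ S, (z - s) ^ n s) * z ^ (-∑ s ∈ S, (n s : ℤ)) := by
      rw [← Nat.cast_sum, zpow_neg, zpow_natCast, ← inv_pow, ← Finset.prod_pow_eq_pow_sum,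
        ← Finset.prod_mul_distrib]
      refine Finset.prod_congr rfl fun s _ => ?_
      rw [← mul_pow, sub_mul, mul_inv_cancel₀ hz0]
    have hzp := zpow_ne_zero (-∑ s ∈ S, (n s : ℤ)) hz0
    rw [Pi.div_apply, hfac z hz.le, hQ, hN, neg_sub, zpow_sub₀ hz0, zpow_natCast]
    rw [zpow_neg] at hzp ⊢
    have hzp' := inv_ne_zero hzp
    rw [inv_inv] at hzp'
    field_simp
  -- This is `G(z) z^(-N)` read at `ζ = 1/z`; the value at `0` is its limit at infinity.
  set g : ℂ → ℂ := fun ζ => if ζ = 0 then 1 else G ζ⁻¹ * ζ ^ N with hg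
  have hinv : ∀ ζ ∈ closedBall (0 : ℂ) 1, ζ ≠ 0 → 1 ≤ ‖ζ⁻¹‖ := fun ζ hζ h0 => by
    rw [mem_closedBall_zero_iff] at hζ
    rw [norm_inv]
    exact (one_le_inv₀ (norm_pos_iff.2 h0)).2 hζ
  have hgc : ContinuousOn g (closedBall 0 1) := by
    intro ζ hζ
    rcases eq_or_ne ζ 0 with rfl | h0
    · refine ContinuousAt.continuousWithinAt ?_
      rw [continuousAt_iff_punctured_nhds]
      have h1 := hGinf.comp (tendsto_inv₀_nhdsNE_zero (α := ℂ))
      have hg0 : g 0 = 1 := by simp [hg]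
      rw [hg0]
      refine h1.congr' ?_
      filter_upwards [self_mem_nhdsWithin] with ζ hζ
      have hζ0 : ζ ≠ 0 := hζ
      simp [hg, hζ0]
    · have hc : ContinuousWithinAt (fun ζ => G ζ⁻¹ * ζ ^ N) (closedBall 0 1 ∩ {0}ᶜ) ζ := by
        refine ContinuousWithinAt.mul ?_
          (continuousAt_zpow₀ ζ N (Or.inl h0)).continuousWithinAt
        exact ContinuousWithinAt.comp (hG ζ⁻¹ (hinv ζ hζ h0))
          (continuousAt_inv₀ h0).continuousWithinAt fun x hx => hinv x hx.1 hx.2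
      have hc' : ContinuousWithinAt g (closedBall 0 1 ∩ {0}ᶜ) ζ :=
        hc.congr (fun x hx => by simp [hg, show x ≠ 0 from hx.2])
        (by simp [hg, h0])
      exact (continuousWithinAt_inter (isOpen_compl_singleton.mem_nhds h0)).1 hc'
  have hg0 : ∀ ζ ∈ closedBall (0 : ℂ) 1, g ζ ≠ 0 := by
    intro ζ hζ
    rcases eq_or_ne ζ 0 with rfl | h0
    · simp [hg]
    · simp only [hg, h0, if_false]
      exact mul_ne_zero (hG0 _ (hinv ζ hζ h0)) (zpow_ne_zero _ h0)
  obtain ⟨L, hLc, hL⟩ := exists_continuous_log_closedBall hgc hg0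
  have hlog : ∀ s, ∃ ℓ : ℂ → ℂ, s ∈ S → ContinuousOn ℓ (sphere 0 1) ∧
      ∀ x ∈ sphere (0 : ℂ) 1, Complex.exp (ℓ x) = x - s := fun s => by
    by_cases hs : s ∈ S
    · obtain ⟨ℓ, hℓ⟩ := exists_log_exp_sub (hS s hs)
      exact ⟨ℓ, fun _ => hℓ⟩
    · exact ⟨0, fun h => absurd h hs⟩
  choose ℓ hℓ using hlog
  have hexp : Continuous fun θ : ℝ => Complex.exp (Complex.I * (θ : ℂ)) := by fun_prop
  have hunit : ∀ θ : ℝ, ‖Complex.exp (Complex.I * (θ : ℂ))‖ = 1 := fun θ => by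
    rw [mul_comm]; exact Complex.norm_exp_ofReal_mul_I θ
  have hsph : ∀ θ : ℝ, Complex.exp (Complex.I * (θ : ℂ)) ∈ sphere (0 : ℂ) 1 := fun θ => by
    rw [mem_sphere_zero_iff_norm, hunit]
  -- The first two terms are functions of `e^{iθ}` and return to their initial values; only `N i θ`
  -- contributes to the increment.
  refine ⟨fun θ => ∑ s ∈ S, n s * ℓ s (Complex.exp (Complex.I * (θ : ℂ))) +
    L (Complex.exp (Complex.I * (θ : ℂ)))⁻¹ + N * (Complex.I * (θ : ℂ)), ?_, ?_, ?_⟩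
  · refine Continuous.continuousOn ?_
    refine Continuous.add (Continuous.add ?_ ?_) (by fun_prop)
    · exact continuous_finsetSum _ fun s hs =>
        continuous_const.mul ((hℓ s hs).1.comp_continuous hexp hsph)
    · exact hLc.comp (hexp.inv₀ fun θ => Complex.exp_ne_zero _)
  · intro θ _
    have hx0 := Complex.exp_ne_zero (Complex.I * (θ : ℂ))
    simp only [sub_zero]
    rw [hfac _ (hunit θ).ge, Complex.exp_add, Complex.exp_add, Complex.exp_sum, mul_assoc,
      hL _ (by rw [mem_closedBall_zero_iff, norm_inv, hunit, inv_one]), Complex.exp_int_mul]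
    congr 1
    · refine Finset.prod_congr rfl fun s hs => ?_
      rw [Complex.exp_nat_mul, (hℓ s hs).2 _ (hsph θ)]
    · simp only [hg, inv_eq_zero, hx0, if_false, inv_inv]
      rw [mul_assoc, inv_zpow, inv_mul_cancel₀ (zpow_ne_zero _ hx0), mul_one]
  · have e1 : Complex.exp (Complex.I * ((2 * Real.pi : ℝ) : ℂ)) = 1 := by
      rw [mul_comm]
      push_cast
      exact Complex.exp_two_pi_mul_I
    simp only [e1, Complex.ofReal_zero, mul_zero, Complex.exp_zero]
    push_cast
    ring

/-! ### Zeros in the exterior: finiteness and factorization. -/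

theorem not_eqOn_zero_of_tendsto {f : ℂ → ℂ} {r : ℕ}
    (hinf : Tendsto (fun z => f z / z ^ r) (Bornology.cobounded ℂ) (𝓝 1)) :
    ¬ Set.EqOn f 0 {z | 1 < ‖z‖} := by
  intro h
  have h0 : Tendsto (fun z => f z / z ^ r) (Bornology.cobounded ℂ) (𝓝 0) := by
    refine tendsto_const_nhds.congr' ?_
    filter_upwards [tendsto_norm_cobounded_atTop.eventually_gt_atTop 1] with z hz
    have : f z = 0 := h hz
    rw [this, zero_div]
  exact one_ne_zero (tendsto_nhds_unique hinf h0)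

/-- The limit at infinity bounds the zeros, so infinitely many would accumulate at a zero in the
closed exterior. It cannot lie on the circle by `h0`, nor outside by the identity theorem. -/
theorem finite_zeros_exterior {f : ℂ → ℂ} {r : ℕ} (hf : AnalyticOnNhd ℂ f {z | 1 < ‖z‖})
    (hc : ContinuousOn f {z | 1 ≤ ‖z‖}) (h0 : ∀ z, ‖z‖ = 1 → f z ≠ 0)
    (hinf : Tendsto (fun z => f z / z ^ r) (Bornology.cobounded ℂ) (𝓝 1)) :
    {z : ℂ | 1 < ‖z‖ ∧ f z = 0}.Finite := by
  by_contra hnf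
  have hev : ∀ᶠ z in Bornology.cobounded ℂ, f z ≠ 0 := by
    filter_upwards [hinf.eventually_ne one_ne_zero] with z hz h
    exact hz (by rw [h, zero_div])
  obtain ⟨R, -, hR⟩ := (hasBasis_cobounded_norm (E := ℂ)).mem_iff.1 hev
  have hsub : {z : ℂ | 1 < ‖z‖ ∧ f z = 0} ⊆ closedBall 0 R := by
    intro z hz
    by_contra hzR
    rw [mem_closedBall_zero_iff, not_le] at hzR
    exact hR hzR.le hz.2
  obtain ⟨x, -, hx⟩ := Set.Infinite.exists_accPt_of_subset_isCompact hnf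
    (isCompact_closedBall 0 R) hsub
  have hclosed : IsClosed ({z : ℂ | 1 ≤ ‖z‖} ∩ f ⁻¹' {0}) :=
    hc.preimage_isClosed_of_isClosed (isClosed_le continuous_const continuous_norm)
      isClosed_singleton
  rw [accPt_iff_frequently_nhdsNE] at hx
  have hxm : x ∈ {z : ℂ | 1 ≤ ‖z‖} ∩ f ⁻¹' {0} := by
    rw [← hclosed.closure_eq, mem_closure_iff_frequently]
    exact (hx.filter_mono nhdsWithin_le_nhds).mono fun z hz => ⟨le_of_lt hz.1, hz.2⟩
  have hx1 : 1 < ‖x‖ := lt_of_le_of_ne hxm.1 fun h => h0 x h.symm hxm.2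
  exact not_eqOn_zero_of_tendsto hinf
    (hf.eqOn_zero_of_preconnected_of_frequently_eq_zero isPreconnected_exterior hx1
      (hx.mono fun z hz => hz.2))

/-- Dividing an analytic function by its zeros. -/
theorem exists_factorization_exterior {f : ℂ → ℂ} (hf : AnalyticOnNhd ℂ f {z | 1 < ‖z‖})
    (hc : ContinuousOn f {z | 1 ≤ ‖z‖}) (hne : ¬ Set.EqOn f 0 {z | 1 < ‖z‖}) (S : Finset ℂ)
    (hS : ∀ z, 1 ≤ ‖z‖ → (z ∈ S ↔ f z = 0)) (hS1 : ∀ s ∈ S, 1 < ‖s‖) :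
    ∃ G : ℂ → ℂ, ContinuousOn G {z | 1 ≤ ‖z‖} ∧ (∀ z, 1 ≤ ‖z‖ → G z ≠ 0) ∧
      ∀ z, 1 ≤ ‖z‖ → f z = (∏ s ∈ S, (z - s) ^ analyticOrderNatAt f s) * G z := by
  classical
  set n : ℂ → ℕ := analyticOrderNatAt f with hn
  have hloc : ∀ s, ∃ g : ℂ → ℂ, s ∈ S → ContinuousAt g s ∧ g s ≠ 0 ∧
      ∀ᶠ z in 𝓝 s, f z = (z - s) ^ n s * g z := fun s => by
    by_cases hs : s ∈ S
    · have htop : analyticOrderAt f s ≠ ⊤ := fun h => hne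
        (hf.eqOn_zero_of_preconnected_of_eventuallyEq_zero isPreconnected_exterior (hS1 s hs)
          (analyticOrderAt_eq_top.1 h))
      obtain ⟨g, hg, hg0, hgf⟩ := (hf s (hS1 s hs)).analyticOrderAt_ne_top.1 htop
      exact ⟨g, fun _ => ⟨hg.continuousAt, hg0, hgf⟩⟩
    · exact ⟨0, fun h => absurd h hs⟩
  choose g hg using hloc
  have hP0 : ∀ (T : Finset ℂ) (z : ℂ), z ∉ T → ∏ s ∈ T, (z - s) ^ n s ≠ 0 := fun T z hz =>
    Finset.prod_ne_zero_iff.2 fun s hs => pow_ne_zero _ (sub_ne_zero.2 fun h => hz (h ▸ hs))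
  have hPc : ∀ T : Finset ℂ, Continuous fun z : ℂ => ∏ s ∈ T, (z - s) ^ n s := fun T => by
    fun_prop
  have hn0 : ∀ s ∈ S, n s ≠ 0 := by
    intro s hs h
    have hfs := (hg s hs).2.2.self_of_nhds
    rw [h, pow_zero, one_mul, (hS s (hS1 s hs).le).1 hs] at hfs
    exact (hg s hs).2.1 hfs.symm
  -- At a zero `z` the removable value of the quotient is the local cofactor at `z` divided by the
  -- factors of the other zeros.
  set G : ℂ → ℂ := fun z => if z ∈ S then g z z / ∏ s ∈ S.erase z, (z - s) ^ n s
    else f z / ∏ s ∈ S, (z - s) ^ n s with hG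
  refine ⟨G, ?_, ?_, ?_⟩
  · intro z hz
    by_cases hzS : z ∈ S
    · refine ContinuousAt.continuousWithinAt ?_
      have hca : ContinuousAt (fun x => g z x / ∏ s ∈ S.erase z, (x - s) ^ n s) z :=
        (hg z hzS).1.div (hPc _).continuousAt (hP0 _ z (Finset.notMem_erase z S))
      refine hca.congr ?_
      have hnot : ∀ᶠ x in 𝓝 z, x ∉ S.erase z :=
        (S.erase z).finite_toSet.isClosed.isOpen_compl.mem_nhds
          (by simp)
      filter_upwards [(hg z hzS).2.2, hnot] with x hx hxS
      rcases eq_or_ne x z with rfl | hxz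
      · simp [hG, hzS]
      · have hxS' : x ∉ S := fun h => hxS (Finset.mem_erase.2 ⟨hxz, h⟩)
        have hpow : (x - z) ^ n z ≠ 0 := pow_ne_zero _ (sub_ne_zero.2 hxz)
        simp only [hG, hxS', if_false]
        rw [hx, ← Finset.mul_prod_erase S _ hzS, mul_div_mul_left _ _ hpow]
    · have hcw : ContinuousWithinAt (fun x => f x / ∏ s ∈ S, (x - s) ^ n s) {z | 1 ≤ ‖z‖} z :=
        (hc z hz).div (hPc S).continuousWithinAt (hP0 S z hzS)
      refine hcw.congr_of_eventuallyEq ?_ (by simp [hG, hzS])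
      have hnot : ∀ᶠ x in 𝓝 z, x ∉ S :=
        S.finite_toSet.isClosed.isOpen_compl.mem_nhds (by simpa using hzS)
      filter_upwards [nhdsWithin_le_nhds hnot] with x hx
      simp [hG, show x ∉ S from hx]
  · intro z hz
    by_cases hzS : z ∈ S
    · simp only [hG, hzS, if_true]
      exact div_ne_zero (hg z hzS).2.1 (hP0 _ z (Finset.notMem_erase z S))
    · simp only [hG, hzS, if_false]
      exact div_ne_zero (fun h => hzS ((hS z hz).2 h)) (hP0 S z hzS)
  · intro z hz
    by_cases hzS : z ∈ S
    · rw [(hS z hz).1 hzS, ← Finset.mul_prod_erase S _ hzS, sub_self, zero_pow (hn0 z hzS)]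
      simp
    · simp only [hG, hzS, if_false]
      rw [mul_div_cancel₀ _ (hP0 S z hzS)]

/-- The argument principle in the exterior of the unit disk, for a function that grows like `z ^ r`
at infinity. -/
theorem sum_analyticOrderNatAt_exterior {f : ℂ → ℂ} {r : ℕ}
    (hf : AnalyticOnNhd ℂ f {z | 1 < ‖z‖}) (hc : ContinuousOn f {z | 1 ≤ ‖z‖})
    (h0 : ∀ z, ‖z‖ = 1 → f z ≠ 0)
    (hinf : Tendsto (fun z => f z / z ^ r) (Bornology.cobounded ℂ) (𝓝 1)) :
    ∑ᶠ z ∈ {z : ℂ | 1 < ‖z‖ ∧ f z = 0}, (analyticOrderNatAt f z : ℤ) =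
      (r : ℤ) - windingNumber (fun θ : ℝ => f (Complex.exp (Complex.I * (θ : ℂ)))) 0 := by
  have hfin := finite_zeros_exterior hf hc h0 hinf
  have hS : ∀ z, 1 ≤ ‖z‖ → (z ∈ hfin.toFinset ↔ f z = 0) := fun z hz => by
    rw [Set.Finite.mem_toFinset]
    exact ⟨fun h => h.2, fun h => ⟨lt_of_le_of_ne hz fun h1 => h0 z h1.symm h, h⟩⟩
  have hS1 : ∀ s ∈ hfin.toFinset, 1 < ‖s‖ := fun s hs => (hfin.mem_toFinset.1 hs).1
  obtain ⟨G, hGc, hG0, hfac⟩ := exists_factorization_exterior hf hc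
    (not_eqOn_zero_of_tendsto hinf) hfin.toFinset hS hS1
  rw [windingNumber_eq (hasWindingNumber_of_factorization hS1 hGc hG0 hfac hinf),
    finsum_mem_eq_finite_toFinset_sum _ hfin]
  ring

end KreissLopatinskii

end

open KreissLopatinskii in
/-- Holomorphy of `Δ` on `{|z| > 1}` and its continuity on `{|z| ≥ 1}` are part of the conclusion:
they give a meaning to the multiplicities of the zeros and to the winding number. -/
theorem corollary3p2 (r p m : ℕ) (hr : 1 ≤ r) (hp : 1 ≤ p) (hm : p + r ≤ m)
    (a : ℤ → ℂ) (har : a (-(r : ℤ)) ≠ 0) (hap : a (p : ℤ) ≠ 0)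
    (B : Matrix (Fin r) (Fin m) ℂ)
    (hstab : CauchyStable r p a)
    (h0 : ∀ z : ℂ, ‖z‖ = 1 → intrinsicDet r p m a B z ≠ 0) :
    AnalyticOnNhd ℂ (intrinsicDet r p m a B) {z : ℂ | 1 < ‖z‖} ∧
    ContinuousOn (intrinsicDet r p m a B) {z : ℂ | 1 ≤ ‖z‖} ∧
    {z : ℂ | 1 < ‖z‖ ∧ intrinsicDet r p m a B z = 0}.Finite ∧
    ∑ᶠ z ∈ {z : ℂ | 1 < ‖z‖ ∧ intrinsicDet r p m a B z = 0},
        (analyticOrderNatAt (intrinsicDet r p m a B) z : ℤ) =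
      (r : ℤ) - windingNumber
        (fun θ : ℝ => intrinsicDet r p m a B (Complex.exp (Complex.I * (θ : ℂ)))) 0 := by
  have hf := (differentiableOn_intrinsicDet hr hstab har B).analyticOnNhd isOpen_exterior
  have hc := continuousOn_intrinsicDet hr hstab har B
  have hinf := tendsto_intrinsicDet hr hstab har B
  exact ⟨hf, hc, finite_zeros_exterior hf hc h0 hinf,
    sum_analyticOrderNatAt_exterior hf hc h0 hinf⟩
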